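/- **Setting.** Consider a time-inhomogeneous Markov decision process with horizon $H\ge 1$, a measurable state space $\mathcal S$, $A\ge 1$ actions, initial law $p_0$, transition laws $\mathbb P_h(\cdot\mid s,a)$ and reward laws $R_h(s,a)$ on $[0,1]$, $h=0,\dots,H-1$. For a (Markov, randomized) policy $\pi$, let $V_h^\pi(s)=\mathbb E[\sum_{l=h}^{H-1}r_l\mid s_h=s]$, let $Q_h^\pi(s,a)$ be the action value, and let $d_h^\pi$ be the law of $s_h$. Let $\phi$ be a measurable feature map from $\mathcal S$ to a measurable space (for instance $\mathbb R^d$). A *feature policy* is a policy for which $\pi_h(\cdot\mid s)$ is a measurable function of $\phi(s)$. Assume that for every feature policy $\pi$, $Q^\pi_h(s,a)$ is a measurable function of $\phi(s)$. Let $\pi^\star$ be an optimal policy and $\pi^g$ a feature policy (the guide) such that, for a constant $C$, $$\sup_{s,h}\ \frac{d_h^{\pi^\star}(\phi(s))}{d_h^{\pi^g}(\phi(s))}\le C,$$ i.e. the law of $\phi(s_h)$ under $\pi^\star$ is at most $C$ times its law under $\pi^g$, for each $h$. **Regression oracle.** An offline regression oracle measurably maps $n$ trajectories to predictors $\widehat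 Q_h(s,a)$, $0\le h<H$, that depend on $s$ through $\phi(s)$. Assume that for every feature policy $\pi$, every $n\ge1$ and every $h$, if the oracle is given $n$ independent trajectories of $\pi$, then $$\mathbb E\big[(\widehat Q_h(s,a)-Q_h^\pi(s,a))^2\big]\le\mathcal E_{\mathcal F}(n),$$ where the expectation is over the training data and an independent pair $s\sim d_h^\pi$, $a\sim\pi_h(s)$. The function $\mathcal E_{\mathcal F}$ is nonincreasing on $n\ge1$ and decays at most quadratically: for some $\kappa$, $$m\sqrt{\mathcal E_{\mathcal F}(m)}\le\kappa\, n\sqrt{\mathcal E_{\mathcal F}(n)}\quad(1\le m\le n),\qquad H\le\kappa\, n\sqrt{\mathcal E_{\mathcal F}(n)}\quad(n\ge1).$$ (Every polynomial rate $\mathcal E_{\mathcal F}(n)=Bn^{-\rho}$ with $B>0$, $0\le\rho\le2$ satisfies this with $\kappa=\max(1,H/\sqrt B)$.) **FALCON+** (at step $h$). Rounds $1,2,\dots$ are divided into epochs: epoch $m$ consists of the rounds $\tau_{m-1}+1,\dots,\tau_m$, with $\tau_0=0$ and $\tau_m=2^m$ for $m\ge 1$. In epoch $1$ actions are uniform.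 In epoch $m\ge2$, let $n=\tau_{m-1}-\tau_{m-2}$, let $\widehat f=\widehat Q_h$ be the oracle's predictor from the $n$ trajectories of epoch $m-1$ only, let $\gamma=\tfrac12\sqrt{A/\mathcal E_{\mathcal F}(n)}$ and $\widehat a(s)=\arg\max_a\widehat f(s,a)$ (smallest index in case of ties); play $a\neq\widehat a(s)$ with probability $1/\big(A+\gamma(\widehat f(s,\widehat a(s))-\widehat f(s,a))\big)$, and $\widehat a(s)$ with the remaining probability. **JSRL.** Start with $\pi=\pi^g$ and let $N=\lceil T/H\rceil$, $T\ge 1$. For $h=H-1,\dots,0$: run FALCON+ at step $h$ for $N$ rounds, where in each round a trajectory is collected in which step $h$ follows FALCON+ and all other steps follow the current $\pi$; then replace $\pi_h$ by the uniform mixture of the $N$ policies that FALCON+ executed at step $h$. **Claim.** The law of the collected trajectories is a well-defined probability law, the suboptimality $\mathbb E_{s_0\sim p_0}[V_0^{\pi^\star}(s_0)-V_0^{\pi}(s_0)]$ of the output policy $\pi$ is integrable with respect to it, and its expectation over the run of the algorithm is $\tilde O\big(C\sum_{h=1}^H\sqrt{A\,\mathcal E_{\mathcal F}(T/H)}\big)$: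 there is a universal constant $c>0$ such that in all of the above situations $$\mathbb E\Big[\mathbb E_{s_0\sim p_0}\big[V_0^{\pi^\star}(s_0)-V_0^{\pi}(s_0)\big]\Big]\le c\,\kappa\,(1+\log T)\cdot C\sum_{h=1}^H\sqrt{A\,\mathcal E_{\mathcal F}(\lceil T/H\rceil)}.$$ -/

import Mathlib

open MeasureTheory ProbabilityTheory
open scoped NNReal ENNReal

noncomputable section

namespace JSRL

/-! ### Finite-horizon time-inhomogeneous MDPs with `K` actions -/

/-- A time-inhomogeneous Markov decision process with state space `S` and the `K` actions `Fin K`: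
initial law, reward laws `R_h(s, a)` supported in `[0, 1]`, and transition laws `P_h(· | s, a)`.
With horizon `H`, only the steps `h = 0, …, H - 1` are used. -/
structure MDP (S : Type*) [MeasurableSpace S] (K : ℕ) where
  init : Measure S
  reward : ℕ → Kernel (S × Fin K) ℝ
  trans : ℕ → Kernel (S × Fin K) S
  init_prob : IsProbabilityMeasure init
  reward_markov : ∀ h, IsMarkovKernel (reward h)
  trans_markov : ∀ h, IsMarkovKernel (trans h)
  reward_mem : ∀ h x, ∀ᵐ r ∂(reward h x), r ∈ Set.Icc (0 : ℝ) 1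

/-- One step of interaction: `(s_h, a_h, r_h, s_{h+1})`. -/
abbrev Step (S : Type*) (K : ℕ) := S × Fin K × ℝ × S

/-- A trajectory: `n` consecutive steps. -/
abbrev Traj (S : Type*) (K n : ℕ) := Fin n → Step S K

/-- A (Markov, randomized) policy: `π h s a` is the probability of action `a` at step `h` in
state `s`. Validity is expressed by `IsPolicy`. -/
abbrev Policy (S : Type*) (K : ℕ) := ℕ → S → Fin K → ℝ

structure IsPolicy {S : Type*} [MeasurableSpace S] {K : ℕ} (π : Policy S K) : Prop where
  nonneg : ∀ h s a, 0 ≤ π h s a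
  sum_eq_one : ∀ h s, ∑ a, π h s a = 1
  measurable : ∀ h a, Measurable fun s => π h s a

/-- `f(s)` depends on `s` only through the feature `φ(s)`. -/
def DependsOnFeature {S X : Type*} [MeasurableSpace X] (φ : S → X) (f : S → ℝ) : Prop :=
  ∃ g : X → ℝ, Measurable g ∧ ∀ s, f s = g (φ s)

/-- The policy depends on the state only through its feature. -/
def IsFeaturePolicy {S X : Type*} [MeasurableSpace X] {K : ℕ} (φ : S → X) (π : Policy S K) :
    Prop :=
  ∀ h a, DependsOnFeature φ fun s => π h s a

namespace MDP

variable {S : Type*} [MeasurableSpace S] {K : ℕ}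

/-- Law of `(s, a, r, s')` for `a ∼ π_h(s)`, `r ∼ R_h(s, a)`, `s' ∼ P_h(· | s, a)`. -/
def stepLaw (M : MDP S K) (π : Policy S K) (h : ℕ) (s : S) : Measure (Step S K) :=
  ∑ a, ENNReal.ofReal (π h s a) •
    ((M.reward h (s, a)).prod (M.trans h (s, a))).map fun y => (s, a, y.1, y.2)

/-- Law of the `n` steps `h, h + 1, …, h + n - 1` when `π` is followed from state `s` at step `h`. -/
def rollout (M : MDP S K) (π : Policy S K) : (n : ℕ) → (h : ℕ) → S → Measure (Traj S K n)
  | 0, _, _ => Measure.dirac Fin.elim0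
  | n + 1, h, s => (M.stepLaw π h s).bind fun x =>
      (M.rollout π n (h + 1) x.2.2.2).map fun τ => Fin.cons (α := fun _ => Step S K) x τ

/-- Law of a full trajectory of `π`, with `s_0` drawn from the initial law. -/
def trajLaw (M : MDP S K) (H : ℕ) (π : Policy S K) : Measure (Traj S K H) :=
  M.init.bind (M.rollout π H 0)

/-- The state occupancy law `d_h^π`. -/
def occupancy (M : MDP S K) (H : ℕ) (π : Policy S K) (h : Fin H) : Measure S :=
  (M.trajLaw H π).map fun τ => (τ h).1

/-- The value function `V_h^π(s) = 𝔼[∑_{l=h}^{H-1} r_l | s_h = s]`. -/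
def V (M : MDP S K) (H : ℕ) (π : Policy S K) (h : ℕ) (s : S) : ℝ :=
  ∫ τ, ∑ i, (τ i).2.2.1 ∂(M.rollout π (H - h) h s)

/-- The action value `Q_h^π(s, a)`: play `a` at step `h`, and follow `π` afterwards. -/
def Q (M : MDP S K) (H : ℕ) (π : Policy S K) (h : ℕ) (s : S) (a : Fin K) : ℝ :=
  (∫ r, r ∂(M.reward h (s, a))) + ∫ s', M.V H π (h + 1) s' ∂(M.trans h (s, a))

/-- `π` maximizes the expected total reward among all policies. -/
def IsOptimal (M : MDP S K) (H : ℕ) (π : Policy S K) : Prop :=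
  IsPolicy π ∧ ∀ π' : Policy S K, IsPolicy π' →
    ∫ s, M.V H π' 0 s ∂M.init ≤ ∫ s, M.V H π 0 s ∂M.init

/-- `𝔼_{s_0}[V_0^{π'}(s_0) - V_0^π(s_0)]`; the suboptimality of `π` if `π'` is optimal. -/
def gap (M : MDP S K) (H : ℕ) (π' π : Policy S K) : ℝ :=
  ∫ s, (M.V H π' 0 s - M.V H π 0 s) ∂M.init

/-- State coverage in feature space: `d_h^{π'}(φ(s)) ≤ C · d_h^{πg}(φ(s))` for all `s` and `h`,
as an inequality between the laws of `φ(s_h)`. -/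
def Covers {X : Type*} [MeasurableSpace X] (M : MDP S K) (H : ℕ) (φ : S → X)
    (πg π' : Policy S K) (C : ℝ≥0) : Prop :=
  ∀ h : Fin H, (M.occupancy H π' h).map φ ≤ C • (M.occupancy H πg h).map φ

end MDP

/-! ### The offline regression oracle -/

/-- An offline regression oracle: it maps `n` trajectories to a family of predictors
`Qhat_h(s, a)`. As all policies here see the state through its feature only, so do the predictors. -/
abbrev Oracle (S X : Type*) (K H : ℕ) :=
  (n : ℕ) → (Fin n → Traj S K H) → ℕ → X → Fin K → ℝ

def Oracle.IsMeasurable {S X : Type*} [MeasurableSpace S] [MeasurableSpace X] {K H : ℕ}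
    (O : Oracle S X K H) : Prop :=
  ∀ n h a, Measurable fun p : (Fin n → Traj S K H) × X => O n p.1 h p.2 a

/-- For every policy `π`, every step `h` and every `n ≥ 1`, if the oracle gets `n` independent
trajectories of `π`, then `𝔼[(Qhat_h(s, a) - Q_h^π(s, a))²] ≤ E n`, where the expectation is over
the training data and an independent pair `(s, a)`, `s ∼ d_h^π`, `a ∼ π_h(s)`. -/
def Oracle.HasError {S X : Type*} [MeasurableSpace S] [MeasurableSpace X] {K H : ℕ}
    (O : Oracle S X K H) (M : MDP S K) (φ : S → X) (E : ℕ → ℝ) : Prop :=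
  ∀ π : Policy S K, IsPolicy π → IsFeaturePolicy φ π → ∀ n : ℕ, 1 ≤ n → ∀ h : Fin H,
    ∫⁻ D, ∫⁻ τ, ENNReal.ofReal
        ((O n D h (φ (τ h).1) (τ h).2.1 - M.Q H π h (τ h).1 (τ h).2.1) ^ 2)
      ∂(M.trajLaw H π) ∂(Measure.pi fun _ : Fin n => M.trajLaw H π) ≤ ENNReal.ofReal (E n)

/-! ### FALCON+ -/

/-- The greedy action: the maximizer of `f` with the smallest index. -/
def greedy {K : ℕ} [NeZero K] (f : Fin K → ℝ) : Fin K :=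
  (Finset.univ.filter fun a => ∀ b, f b ≤ f a).min' (by
    obtain ⟨a, ha⟩ := Finite.exists_max f
    exact ⟨a, by simpa using ha⟩)

/-- Inverse gap weighting with learning rate `γ`. -/
def invGap {K : ℕ} [NeZero K] (γ : ℝ) (f : Fin K → ℝ) (a : Fin K) : ℝ :=
  if a = greedy f then 1 - ∑ b ∈ Finset.univ.erase (greedy f), 1 / (K + γ * (f (greedy f) - f b))
  else 1 / (K + γ * (f (greedy f) - f a))

/-- The epoch schedule `0, 2, 4, 8, …`: epoch `m ≥ 1` consists of the rounds `t`, counted from `0`,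
with `epochEnd (m - 1) ≤ t < epochEnd m`; that is, `m = log₂ t + 1` (and `m = 1` for `t = 0`). -/
def epochEnd (m : ℕ) : ℕ := if m = 0 then 0 else 2 ^ m

theorem epochEnd_log_le (t : ℕ) : epochEnd (Nat.log 2 t) ≤ t := by
  unfold epochEnd
  split_ifs with h
  · exact Nat.zero_le t
  · refine Nat.pow_log_le_self 2 ?_
    rintro rfl
    simp at h

/-- The action distribution of FALCON+ in round `t`, for a contextual bandit that consists in
choosing the action at step `h`, given the trajectories `D` of the earlier rounds. In the first
epoch the predictor is `0` and the learning rate is `1`, so that the distribution is uniform. In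
epoch `m ≥ 2` (here `m = k + 1`), the oracle gets exactly the `n` trajectories of epoch `m - 1`, and
the learning rate is `√(K / E n) / 2`. -/
def falcon {S X : Type*} {K H : ℕ} [NeZero K] (O : Oracle S X K H) (E : ℕ → ℝ)
    (h t : ℕ) (D : Fin t → Traj S K H) (x : X) : Fin K → ℝ :=
  let k := Nat.log 2 t
  let n := epochEnd k - epochEnd (k - 1)
  if k = 0 then invGap 1 fun _ => 0
  else
    invGap (Real.sqrt (K / E n) / 2)
      (O n (fun j : Fin n => D ⟨epochEnd (k - 1) + j, by
        have h1 : epochEnd (Nat.log 2 t) ≤ t := epochEnd_log_le t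
        have h2 : (j : ℕ) < epochEnd (Nat.log 2 t) - epochEnd (Nat.log 2 t - 1) := j.2
        change epochEnd (Nat.log 2 t - 1) + (j : ℕ) < t
        omega⟩) h x)

/-! ### The jump-start algorithm with FALCON+ as exploration oracle -/

section Algorithm

variable {S X : Type*} [MeasurableSpace S] {K H : ℕ} [NeZero K]

/-- The policy `π` with its step `h` replaced by `p`. -/
def replaceStep (π : Policy S K) (h : ℕ) (p : S → Fin K → ℝ) : Policy S K :=
  Function.update π h p

/-- The policy at step `h` that the iteration for step `h` returns: the uniform mixture of the
policies that FALCON+ executed in its `N` rounds. -/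
def mixture (O : Oracle S X K H) (E : ℕ → ℝ) (φ : S → X) (h : ℕ) {N : ℕ}
    (D : Fin N → Traj S K H) (s : S) (a : Fin K) : ℝ :=
  (1 / N) * ∑ t : Fin N, falcon O E h t (fun j => D (Fin.castLE t.2.le j)) (φ s) a

/-- The policy after the first `i` iterations (those for the steps `H - 1, …, H - i`), as a function
of the trajectories collected in them. It starts from the guide policy `πg`. -/
def learned (O : Oracle S X K H) (E : ℕ → ℝ) (φ : S → X) (πg : Policy S K) (N : ℕ) :
    (i : ℕ) → (Fin i → Fin N → Traj S K H) → Policy S K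
  | 0, _ => πg
  | i + 1, D =>
      replaceStep (learned O E φ πg N i fun j => D j.castSucc) (H - 1 - i)
        (mixture O E φ (H - 1 - i) (D (Fin.last i)))

/-- Law of the trajectories of the first `t` rounds of FALCON+ at step `h`, where all other steps of
each trajectory follow `π`. -/
def iterLaw (M : MDP S K) (O : Oracle S X K H) (E : ℕ → ℝ) (φ : S → X) (π : Policy S K) (h : ℕ) :
    (t : ℕ) → Measure (Fin t → Traj S K H)
  | 0 => Measure.dirac Fin.elim0
  | t + 1 => (iterLaw M O E φ π h t).bind fun D =>
      (M.trajLaw H (replaceStep π h fun s => falcon O E h t D (φ s))).map fun τ =>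
        Fin.snoc (α := fun _ => Traj S K H) D τ

/-- Law of all trajectories collected in the first `i` iterations, with `N` rounds each. -/
def runLaw (M : MDP S K) (O : Oracle S X K H) (E : ℕ → ℝ) (φ : S → X) (πg : Policy S K) (N : ℕ) :
    (i : ℕ) → Measure (Fin i → Fin N → Traj S K H)
  | 0 => Measure.dirac Fin.elim0
  | i + 1 => (runLaw M O E φ πg N i).bind fun D =>
      (iterLaw M O E φ (learned O E φ πg N i D) (H - 1 - i) N).map fun D' =>
        Fin.snoc (α := fun _ => Fin N → Traj S K H) D D'

end Algorithm

end JSRL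

end

open JSRL

noncomputable section

namespace JSRL

/-! ### Parametrized measures -/

section Measure

variable {α β γ : Type*} [MeasurableSpace α] [MeasurableSpace β] [MeasurableSpace γ]

/-! Why JSRL works. The loop runs backwards in `h`, so each iteration is a stationary contextual
bandit: steps before `h` still follow `πg`, hence the context has law `d_h^{πg}`; steps after `h`
are already final, hence the mean return after an action is the `Q_h` of the output policy `π`. The
performance difference inequality `MDP.gap_le_sum_regret` bounds the suboptimality by the sum over
`h` of the one-step losses `MDP.regret` of `π`, measured against the greedy action for its own `Q_h`
and averaged over `d_h^{π⋆}`. These losses are nonnegative functions of the feature, so coverage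
replaces `d_h^{π⋆}` by `d_h^{πg}` at the price of `C` (`MDP.ofReal_gap_le`). What remains is the
bandit regret of each iteration.

Why FALCON+ works. Inverse gap weighting gives action `a` a probability of at least `1 / (K + γ ·
gap)`, so a small mean squared error under the played distribution controls the pointwise error at
every action, up to a fraction of its gap. Hence, state by state, the action gaps of successive
predictors stay within a factor `2` of the true ones, up to an additive `slack` that obeys a
recursion with contraction factor `1/3` (`actionGap_comparison`, `epochPred_comparison`). Within an
epoch the action distribution is frozen, so given the past the trajectories are independent samples
of one feature policy; the oracle guarantee then bounds the expected slack (`lintegral_slack_le`).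

Why the rate follows. With `W = κ N √(K E(N))`, the growth conditions on `E` make the expected
regret of round `t` (from `0`) at most `56 W / (t + 1)`. Averaging over `N` rounds yields a harmonic
sum, hence the logarithm, and `W / N = κ √(K E(N))`.

All laws are iterated `Measure.bind`s, and `bind` is meaningful only for measurable families; the
joint measurability lemmas are what makes the run a probability law. Error and regret bounds are
kept in `ℝ≥0∞`, so no integrability of the arbitrary real predictions is needed. -/

theorem measurable_lintegral_prod {f : α → Measure β} (hf : Measurable f)
    (hp : ∀ a, IsProbabilityMeasure (f a)) {g : α → β → ℝ≥0∞}
    (hg : Measurable fun p : α × β => g p.1 p.2) : Measurable fun a => ∫⁻ b, g a b ∂f a := by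
  let κ : Kernel α β := ⟨f, hf⟩
  have : IsMarkovKernel κ := ⟨hp⟩
  exact hg.lintegral_kernel_prod_right' (κ := κ)

theorem measurable_integral_prod {f : α → Measure β} (hf : Measurable f)
    (hp : ∀ a, IsProbabilityMeasure (f a)) {g : α → β → ℝ}
    (hg : Measurable fun p : α × β => g p.1 p.2) : Measurable fun a => ∫ b, g a b ∂f a := by
  let κ : Kernel α β := ⟨f, hf⟩
  have : IsMarkovKernel κ := ⟨hp⟩
  exact (StronglyMeasurable.integral_kernel_prod_right' (κ := κ) hg.stronglyMeasurable).measurable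

theorem measurable_bind_prod {f : α → Measure β} (hf : Measurable f)
    (hp : ∀ a, IsProbabilityMeasure (f a)) {g : α → β → Measure γ}
    (hg : Measurable fun p : α × β => g p.1 p.2) : Measurable fun a => (f a).bind (g a) := by
  refine Measure.measurable_of_measurable_coe _ fun s hs => ?_
  have h : ∀ a, (f a).bind (g a) s = ∫⁻ b, g a b s ∂f a := fun a =>
    Measure.bind_apply hs (hg.comp measurable_prodMk_left).aemeasurable
  simp_rw [h]
  exact measurable_lintegral_prod hf hp ((Measure.measurable_coe hs).comp hg)

theorem measurable_map_prod {f : α → Measure β} (hf : Measurable f)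
    (hp : ∀ a, IsProbabilityMeasure (f a)) {g : α → β → γ}
    (hg : Measurable fun p : α × β => g p.1 p.2) : Measurable fun a => (f a).map (g a) := by
  have h : ∀ a, (f a).map (g a) = (f a).bind fun b => Measure.dirac (g a b) := fun a =>
    (Measure.bind_dirac_eq_map _ (hg.comp measurable_prodMk_left)).symm
  simp_rw [h]
  exact measurable_bind_prod hf hp (Measure.measurable_dirac.comp hg)

theorem isProbabilityMeasure_bind_of_measurable {μ : Measure α} [IsProbabilityMeasure μ]
    {f : α → Measure β} (hf : Measurable f) (hp : ∀ a, IsProbabilityMeasure (f a)) :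
    IsProbabilityMeasure (μ.bind f) :=
  isProbabilityMeasure_bind hf.aemeasurable (.of_forall hp)

theorem integral_bind_of_integrable {μ : Measure α} [IsProbabilityMeasure μ]
    {f : α → Measure β} (hf : Measurable f) (hp : ∀ a, IsProbabilityMeasure (f a)) {g : β → ℝ}
    (hg : Integrable g (μ.bind f)) : ∫ b, g b ∂μ.bind f = ∫ a, ∫ b, g b ∂f a ∂μ := by
  let κ : Kernel α β := ⟨f, hf⟩
  have : IsMarkovKernel κ := ⟨hp⟩
  change Integrable g (μ.bind κ) at hg
  change ∫ b, g b ∂μ.bind κ = ∫ a, ∫ b, g b ∂κ a ∂μ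
  rw [Measure.comp_eq_comp_const_apply] at hg ⊢
  rw [Kernel.integral_comp hg, Kernel.const_apply]

theorem ae_bind_of_forall {μ : Measure α} {f : α → Measure β} (hf : Measurable f)
    {p : β → Prop} (hm : MeasurableSet {b | p b}) (hp : ∀ᵐ a ∂μ, ∀ᵐ b ∂f a, p b) :
    ∀ᵐ b ∂μ.bind f, p b := by
  have hm' : MeasurableSet {b | ¬ p b} := hm.compl
  rw [ae_iff, Measure.bind_apply hm' hf.aemeasurable,
    lintegral_eq_zero_iff]
  · filter_upwards [hp] with a ha
    simpa [ae_iff] using ha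
  · exact (Measure.measurable_coe hm').comp hf

end Measure

/-! ### Sequential sampling -/

section Seq

variable {Z Ω : Type*} [MeasurableSpace Z] [MeasurableSpace Ω]

theorem measurable_snoc {t : ℕ} :
    Measurable fun p : (Fin t → Z) × Z => Fin.snoc (α := fun _ => Z) p.1 p.2 := by
  refine measurable_pi_iff.2 fun j => ?_
  refine Fin.lastCases ?_ (fun j => ?_) j
  · simpa using measurable_snd
  · simp only [Fin.snoc_castSucc]
    exact (measurable_pi_apply j).comp measurable_fst

theorem measurable_cons {t : ℕ} :
    Measurable fun p : Z × (Fin t → Z) => Fin.cons (α := fun _ => Z) p.1 p.2 := by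
  refine measurable_pi_iff.2 fun j => ?_
  refine Fin.cases ?_ (fun j => ?_) j
  · simpa using measurable_fst
  · simp only [Fin.cons_succ]
    exact (measurable_pi_apply j).comp measurable_snd

/-- Fubini with the last coordinate split off, in the form that matches how `seqLaw` appends
samples. -/
theorem lintegral_pi_snoc {n : ℕ} (ν : Measure Z) [IsProbabilityMeasure ν]
    {F : (Fin (n + 1) → Z) → ℝ≥0∞} (hF : Measurable F) :
    ∫⁻ D, F D ∂(Measure.pi fun _ => ν)
      = ∫⁻ D, ∫⁻ z, F (Fin.snoc (α := fun _ => Z) D z) ∂ν ∂(Measure.pi fun _ : Fin n => ν) := by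
  have h := (measurePreserving_piFinSuccAbove (fun _ : Fin (n + 1) => ν) (Fin.last n)).symm
  rw [← h.map_eq, lintegral_map hF (MeasurableEquiv.measurable _)]
  refine (lintegral_prod_symm' _ (hF.comp (MeasurableEquiv.measurable _))).trans ?_
  simp only [MeasurableEquiv.piFinSuccAbove, Fin.insertNthEquiv_last]
  rfl

/-- Law of `t` successive samples, the next one having law `q t D` given the `t` samples `D`. -/
def seqLaw (q : (t : ℕ) → (Fin t → Z) → Measure Z) : (t : ℕ) → Measure (Fin t → Z)
  | 0 => Measure.dirac Fin.elim0
  | t + 1 => (seqLaw q t).bind fun D => (q t D).map fun z => Fin.snoc (α := fun _ => Z) D z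

variable {q : (t : ℕ) → (Fin t → Z) → Measure Z}

theorem measurable_map_snoc {t : ℕ} {f : (Fin t → Z) → Measure Z} (hm : Measurable f)
    (hp : ∀ D, IsProbabilityMeasure (f D)) :
    Measurable fun D => (f D).map fun z => Fin.snoc (α := fun _ => Z) D z :=
  measurable_map_prod hm hp measurable_snoc

theorem isProbabilityMeasure_seqLaw (t : ℕ) (hm : ∀ s < t, Measurable (q s))
    (hp : ∀ s < t, ∀ D, IsProbabilityMeasure (q s D)) : IsProbabilityMeasure (seqLaw q t) := by
  induction t with
  | zero => rw [seqLaw]; infer_instance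
  | succ t ih =>
    have := ih (fun s hs => hm s (by omega)) (fun s hs => hp s (by omega))
    rw [seqLaw]
    refine isProbabilityMeasure_bind_of_measurable
      (measurable_map_snoc (hm t (by omega)) (hp t (by omega))) fun D => ?_
    have := hp t (by omega) D
    exact Measure.isProbabilityMeasure_map
      (measurable_snoc.comp measurable_prodMk_left).aemeasurable

theorem measurable_seqLaw {q : Ω → (t : ℕ) → (Fin t → Z) → Measure Z} (t : ℕ)
    (hm : ∀ s < t, Measurable fun p : Ω × (Fin s → Z) => q p.1 s p.2)
    (hp : ∀ s < t, ∀ ω D, IsProbabilityMeasure (q ω s D)) :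
    Measurable fun ω => seqLaw (q ω) t := by
  induction t with
  | zero => simp only [seqLaw]; exact measurable_const
  | succ t ih =>
    simp only [seqLaw]
    refine measurable_bind_prod (ih (fun s hs => hm s (by omega)) fun s hs => hp s (by omega))
      (fun ω => isProbabilityMeasure_seqLaw t
        (fun s hs => (hm s (by omega)).comp measurable_prodMk_left)
        fun s hs => hp s (by omega) ω) ?_
    refine measurable_map_prod (f := fun p : Ω × (Fin t → Z) => q p.1 t p.2)
      (g := fun p z => Fin.snoc (α := fun _ => Z) p.2 z) (hm t (by omega))
      (fun p => hp t (by omega) _ _) ?_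
    exact measurable_snoc.comp ((measurable_snd.comp measurable_fst).prodMk measurable_snd)

theorem lintegral_bind_snoc {t : ℕ} {μ : Measure (Fin t → Z)} {f : (Fin t → Z) → Measure Z}
    (hm : Measurable f) (hp : ∀ D, IsProbabilityMeasure (f D)) {F : (Fin (t + 1) → Z) → ℝ≥0∞}
    (hF : Measurable F) :
    ∫⁻ D, F D ∂(μ.bind fun D => (f D).map fun z => Fin.snoc (α := fun _ => Z) D z)
      = ∫⁻ D, ∫⁻ z, F (Fin.snoc (α := fun _ => Z) D z) ∂f D ∂μ := by
  rw [Measure.lintegral_bind (measurable_map_snoc hm hp).aemeasurable hF.aemeasurable]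
  refine lintegral_congr fun D => ?_
  exact lintegral_map hF (measurable_snoc.comp measurable_prodMk_left)

theorem measurable_restrict {s t : ℕ} (h : s ≤ t) :
    Measurable fun (D : Fin t → Z) (j : Fin s) => D (Fin.castLE h j) :=
  measurable_pi_iff.2 fun _ => measurable_pi_apply _

/-- The samples after time `s` come from probability measures, so they integrate out one at a time.
-/
theorem lintegral_seqLaw_restrict {s t : ℕ} (h : s ≤ t) (hm : ∀ r < t, Measurable (q r))
    (hp : ∀ r < t, ∀ D, IsProbabilityMeasure (q r D)) {F : (Fin s → Z) → ℝ≥0∞}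
    (hF : Measurable F) :
    ∫⁻ D, F (fun j => D (Fin.castLE h j)) ∂seqLaw q t = ∫⁻ D, F D ∂seqLaw q s := by
  induction t with
  | zero => obtain rfl : s = 0 := by omega
            rfl
  | succ t ih =>
    rcases Nat.lt_or_ge t s with hs | hs
    · obtain rfl : s = t + 1 := by omega
      rfl
    · rw [← ih hs (fun r hr => hm r (by omega)) (fun r hr => hp r (by omega)), seqLaw]
      refine (lintegral_bind_snoc (hm t (by omega)) (hp t (by omega))
        (hF.comp (measurable_restrict h))).trans ?_
      refine lintegral_congr fun D => ?_
      have := hp t (by omega) D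
      have e : ∀ z, (fun j : Fin s => Fin.snoc (α := fun _ => Z) D z (Fin.castLE h j))
          = fun j => D (Fin.castLE hs j) := fun z => by
        ext j
        have : Fin.castLE h j = (Fin.castLE hs j).castSucc := rfl
        rw [this, Fin.snoc_castSucc]
      simp [e]

/-- Samples drawn while the sampling law stays constant are independent. -/
theorem lintegral_seqLaw_block {s n : ℕ} {p : (Fin s → Z) → Measure Z} (hpm : Measurable p)
    (hpp : ∀ D, IsProbabilityMeasure (p D))
    (hq : ∀ i < n, ∀ D, q (s + i) D = p fun j => D (Fin.castLE (Nat.le_add_right s i) j))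
    {G : (Fin s → Z) → (Fin n → Z) → ℝ≥0∞}
    (hG : Measurable fun x : (Fin s → Z) × (Fin n → Z) => G x.1 x.2) :
    ∫⁻ D, G (fun j => D (Fin.castLE (Nat.le_add_right s n) j)) (fun j => D (Fin.natAdd s j))
        ∂seqLaw q (s + n)
      = ∫⁻ D, ∫⁻ D', G D D' ∂(Measure.pi fun _ => p D) ∂seqLaw q s := by
  induction n with
  | zero =>
    refine lintegral_congr fun D => ?_
    rw [Measure.pi_of_empty, lintegral_dirac]
    congr 1
    ext j
    exact j.elim0
  | succ n ih =>
    have hqn : q (s + n) = fun D => p fun j => D (Fin.castLE (Nat.le_add_right s n) j) :=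
      funext fun D => hq n (by omega) D
    have hm' : Measurable (q (s + n)) := by
      rw [hqn]; exact hpm.comp (measurable_restrict _)
    have hp' : ∀ D, IsProbabilityMeasure (q (s + n) D) := fun D => by rw [hqn]; exact hpp _
    have hGm : Measurable fun x : (Fin s → Z) × (Fin n → Z) =>
        ∫⁻ z, G x.1 (Fin.snoc (α := fun _ => Z) x.2 z) ∂p x.1 :=
      measurable_lintegral_prod (f := fun x : (Fin s → Z) × (Fin n → Z) => p x.1)
        (hpm.comp measurable_fst) (fun x => hpp _)
        (hG.comp ((measurable_fst.comp measurable_fst).prodMk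
          (measurable_snoc.comp ((measurable_snd.comp measurable_fst).prodMk measurable_snd))))
    -- Integrating out the last sample of the block leaves a functional of the first `n`, to which
    -- the induction hypothesis applies. The law `p D` depends only on the samples before the block.
    have key := ih (fun i hi => hq i (by omega))
      (G := fun D D' => ∫⁻ z, G D (Fin.snoc (α := fun _ => Z) D' z) ∂p D) hGm
    have e2 : ∀ D, ∫⁻ D', ∫⁻ z, G D (Fin.snoc (α := fun _ => Z) D' z) ∂p D
        ∂(Measure.pi fun _ => p D) = ∫⁻ D', G D D' ∂(Measure.pi fun _ : Fin (n + 1) => p D) :=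
      fun D => by
        have := hpp D
        exact (lintegral_pi_snoc (p D) (hG.comp measurable_prodMk_left)).symm
    simp_rw [e2] at key
    rw [← key]
    change ∫⁻ D, _ ∂(Measure.bind _ _) = _
    refine (lintegral_bind_snoc (t := s + n) hm' hp' (F := fun D : Fin (s + n + 1) → Z =>
      G (fun j => D (Fin.castLE (Nat.le_add_right s (n + 1)) j))
        (fun j => D (Fin.natAdd s j))) ?_).trans ?_
    · exact hG.comp ((measurable_restrict _).prodMk
        (measurable_pi_iff.2 fun _ => measurable_pi_apply _))
    · refine lintegral_congr fun D => ?_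
      rw [hqn]
      refine lintegral_congr fun z => ?_
      congr 1
      · ext j
        have : Fin.castLE (Nat.le_add_right s (n + 1)) j
          = (Fin.castLE (Nat.le_add_right s n) j).castSucc := rfl
        rw [this, Fin.snoc_castSucc]
      · ext j
        refine Fin.lastCases ?_ (fun j => ?_) j
        · have : Fin.natAdd s (Fin.last n) = Fin.last (s + n) := rfl
          rw [this, Fin.snoc_last, Fin.snoc_last]
        · have : Fin.natAdd s j.castSucc = (Fin.natAdd s j).castSucc := rfl
          rw [this, Fin.snoc_castSucc, Fin.snoc_castSucc]

end Seq

/-! ### Laws of steps, trajectories and states -/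

section Laws

variable {S Ω : Type*} [MeasurableSpace S] [MeasurableSpace Ω] {K : ℕ}

/-- A family of policies that depends measurably on a parameter. -/
structure IsPolicyFamily (π : Ω → Policy S K) : Prop where
  isPolicy : ∀ ω, IsPolicy (π ω)
  measurable : ∀ h a, Measurable fun p : Ω × S => π p.1 h p.2 a

theorem IsPolicy.family {π : Policy S K} (hπ : IsPolicy π) :
    IsPolicyFamily fun _ : Unit => π :=
  ⟨fun _ => hπ, fun h a => (hπ.measurable h a).comp measurable_snd⟩

theorem IsPolicy.sum_ofReal {π : Policy S K} (hπ : IsPolicy π) (h : ℕ) (s : S) :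
    ∑ a, ENNReal.ofReal (π h s a) = 1 := by
  rw [← ENNReal.ofReal_sum_of_nonneg fun a _ => hπ.nonneg h s a, hπ.sum_eq_one,
    ENNReal.ofReal_one]

namespace MDP

variable (M : MDP S K)

instance : IsProbabilityMeasure M.init := M.init_prob
instance (h : ℕ) : IsMarkovKernel (M.reward h) := M.reward_markov h
instance (h : ℕ) : IsMarkovKernel (M.trans h) := M.trans_markov h

theorem measurable_mkStep (s : S) (a : Fin K) :
    Measurable fun y : ℝ × S => ((s, a, y.1, y.2) : Step S K) := by fun_prop

theorem lintegral_stepLaw (π : Policy S K) (h : ℕ) (s : S) {F : Step S K → ℝ≥0∞}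
    (hF : Measurable F) :
    ∫⁻ x, F x ∂M.stepLaw π h s = ∑ a, ENNReal.ofReal (π h s a) *
      ∫⁻ y, F (s, a, y.1, y.2) ∂(M.reward h (s, a)).prod (M.trans h (s, a)) := by
  rw [stepLaw, lintegral_finsetSum_measure]
  refine Finset.sum_congr rfl fun a _ => ?_
  rw [lintegral_smul_measure, lintegral_map hF (measurable_mkStep s a), smul_eq_mul]

variable {M}

theorem isProbabilityMeasure_stepLaw {π : Policy S K} (hπ : IsPolicy π) (h : ℕ) (s : S) :
    IsProbabilityMeasure (M.stepLaw π h s) := by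
  refine ⟨?_⟩
  have := M.lintegral_stepLaw π h s (F := fun _ => 1) measurable_const
  simpa [hπ.sum_ofReal] using this

theorem measurable_stepLaw_family {π : Ω → Policy S K} (hπ : IsPolicyFamily π) (h : ℕ) :
    Measurable fun p : Ω × S => M.stepLaw (π p.1) h p.2 := by
  refine Measure.measurable_of_measurable_coe _ fun A hA => ?_
  simp only [stepLaw, Measure.finsetSum_apply, Measure.smul_apply, smul_eq_mul]
  refine Finset.measurable_fun_sum _ fun a _ => ?_
  refine ((hπ.measurable h a).ennreal_ofReal).mul ?_
  refine (Measure.measurable_coe hA).comp ?_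
  have hk : Measurable fun p : Ω × S => (M.reward h (p.2, a)).prod (M.trans h (p.2, a)) := by
    have h2 : Measurable fun p : Ω × S => (M.reward h ×ₖ M.trans h) (p.2, a) :=
      (M.reward h ×ₖ M.trans h).measurable.comp (measurable_snd.prodMk measurable_const)
    simpa only [Kernel.prod_apply] using h2
  exact measurable_map_prod (g := fun (p : Ω × S) (y : ℝ × S) => ((p.2, a, y.1, y.2) : Step S K))
    hk (fun p => inferInstance) (by fun_prop)

theorem measurable_stepLaw {π : Policy S K} (hπ : IsPolicy π) (h : ℕ) :
    Measurable (M.stepLaw π h) :=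
  (measurable_stepLaw_family (M := M) hπ.family h).comp (measurable_prodMk_left (x := ()))

theorem rollout_measurable_and_prob {π : Ω → Policy S K} (hπ : IsPolicyFamily π) (n h : ℕ) :
    (Measurable fun p : Ω × S => M.rollout (π p.1) n h p.2) ∧
      ∀ ω s, IsProbabilityMeasure (M.rollout (π ω) n h s) := by
  induction n generalizing h with
  | zero => exact ⟨by simpa only [rollout] using measurable_const,
      fun ω s => by rw [rollout]; infer_instance⟩
  | succ n ih =>
    obtain ⟨ih1, ih2⟩ := ih (h + 1)
    have hm : Measurable fun q : (Ω × S) × Step S K =>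
        (M.rollout (π q.1.1) n (h + 1) q.2.2.2.2).map
          fun τ => Fin.cons (α := fun _ => Step S K) q.2 τ := by
      refine measurable_map_prod
        (f := fun q : (Ω × S) × Step S K => M.rollout (π q.1.1) n (h + 1) q.2.2.2.2)
        (g := fun q τ => Fin.cons (α := fun _ => Step S K) q.2 τ) ?_ (fun q => ih2 _ _) ?_
      · exact ih1.comp (by fun_prop : Measurable fun q : (Ω × S) × Step S K =>
          (q.1.1, q.2.2.2.2))
      · exact measurable_cons.comp ((measurable_snd.comp measurable_fst).prodMk measurable_snd)
    refine ⟨?_, fun ω s => ?_⟩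
    · simp only [rollout]
      exact measurable_bind_prod (measurable_stepLaw_family hπ h)
        (fun p => isProbabilityMeasure_stepLaw (hπ.isPolicy _) _ _) hm
    · rw [rollout]
      have := isProbabilityMeasure_stepLaw (M := M) (hπ.isPolicy ω) h s
      refine isProbabilityMeasure_bind_of_measurable
        (hm.comp (measurable_prodMk_left (x := ((ω, s) : Ω × S)))) fun x => ?_
      have := ih2 ω x.2.2.2
      exact Measure.isProbabilityMeasure_map
        (measurable_cons.comp measurable_prodMk_left).aemeasurable

theorem measurable_rollout_family {π : Ω → Policy S K} (hπ : IsPolicyFamily π) (n h : ℕ) :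
    Measurable fun p : Ω × S => M.rollout (π p.1) n h p.2 :=
  (rollout_measurable_and_prob hπ n h).1

theorem measurable_rollout {π : Policy S K} (hπ : IsPolicy π) (n h : ℕ) :
    Measurable (M.rollout π n h) :=
  (measurable_rollout_family (M := M) hπ.family n h).comp (measurable_prodMk_left (x := ()))

theorem isProbabilityMeasure_rollout {π : Policy S K} (hπ : IsPolicy π) (n h : ℕ) (s : S) :
    IsProbabilityMeasure (M.rollout π n h s) :=
  (rollout_measurable_and_prob hπ.family n h).2 () s

theorem measurable_rollout_cons {π : Policy S K} (hπ : IsPolicy π) (n h : ℕ) :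
    Measurable fun x : Step S K => (M.rollout π n h x.2.2.2).map
      fun τ => Fin.cons (α := fun _ => Step S K) x τ :=
  measurable_map_prod (f := fun x : Step S K => M.rollout π n h x.2.2.2)
    (g := fun x τ => Fin.cons (α := fun _ => Step S K) x τ)
    ((measurable_rollout hπ n h).comp (by fun_prop))
    (fun x => isProbabilityMeasure_rollout hπ _ _ _) measurable_cons

theorem lintegral_rollout_succ {π : Policy S K} (hπ : IsPolicy π) (n h : ℕ) (s : S)
    {F : Traj S K (n + 1) → ℝ≥0∞} (hF : Measurable F) :
    ∫⁻ τ, F τ ∂M.rollout π (n + 1) h s = ∫⁻ x, ∫⁻ τ, F (Fin.cons (α := fun _ => Step S K) x τ)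
      ∂M.rollout π n (h + 1) x.2.2.2 ∂M.stepLaw π h s := by
  rw [rollout, Measure.lintegral_bind (measurable_rollout_cons hπ n _).aemeasurable
    hF.aemeasurable]
  refine lintegral_congr fun x => ?_
  exact lintegral_map hF (measurable_cons.comp measurable_prodMk_left)

theorem measurable_trajLaw {π : Ω → Policy S K} (hπ : IsPolicyFamily π) (H : ℕ) :
    Measurable fun ω => M.trajLaw H (π ω) :=
  measurable_bind_prod (f := fun _ : Ω => M.init) measurable_const (fun _ => inferInstance)
    (measurable_rollout_family hπ H 0)

theorem isProbabilityMeasure_trajLaw {π : Policy S K} (hπ : IsPolicy π) (H : ℕ) :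
    IsProbabilityMeasure (M.trajLaw H π) :=
  isProbabilityMeasure_bind_of_measurable (measurable_rollout hπ H 0)
    (isProbabilityMeasure_rollout hπ H 0)

/-! ### The law of the state at a given step -/

variable (M) in
/-- Law of the state at step `h + 1` if `ν` is its law at step `h`. -/
def nextLaw (π : Policy S K) (h : ℕ) (ν : Measure S) : Measure S :=
  (ν.bind (M.stepLaw π h)).map fun x => x.2.2.2

variable (M) in
/-- Law of the state at step `h + i` if `ν` is its law at step `h`. -/
def stateLawFrom (π : Policy S K) (h : ℕ) (ν : Measure S) : ℕ → Measure S
  | 0 => ν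
  | i + 1 => M.nextLaw π (h + i) (stateLawFrom π h ν i)

/-- `stateLawFrom` grows at its end while `rollout` grows at its start; this reconciles the two
recursions. -/
theorem stateLawFrom_succ (π : Policy S K) (h : ℕ) (ν : Measure S) (i : ℕ) :
    M.stateLawFrom π h ν (i + 1) = M.stateLawFrom π (h + 1) (M.nextLaw π h ν) i := by
  induction i with
  | zero => rfl
  | succ i ih => rw [stateLawFrom, ih, stateLawFrom, Nat.add_right_comm h 1 i]; rfl

variable (M) in
/-- Law of the state at step `h`. -/
def stateLaw (π : Policy S K) (h : ℕ) : Measure S := M.stateLawFrom π 0 M.init h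

theorem stateLaw_succ (π : Policy S K) (h : ℕ) :
    M.stateLaw π (h + 1) = M.nextLaw π h (M.stateLaw π h) := by
  rw [stateLaw, stateLawFrom, Nat.zero_add]; rfl

theorem isProbabilityMeasure_nextLaw {π : Policy S K} (hπ : IsPolicy π) (h : ℕ) (ν : Measure S)
    [IsProbabilityMeasure ν] : IsProbabilityMeasure (M.nextLaw π h ν) := by
  have := isProbabilityMeasure_bind_of_measurable (μ := ν) (measurable_stepLaw (M := M) hπ h)
    (isProbabilityMeasure_stepLaw hπ h)
  exact Measure.isProbabilityMeasure_map (by fun_prop)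

theorem isProbabilityMeasure_stateLaw {π : Policy S K} (hπ : IsPolicy π) (h : ℕ) :
    IsProbabilityMeasure (M.stateLaw π h) := by
  induction h with
  | zero => exact M.init_prob
  | succ h ih => rw [stateLaw_succ]; exact isProbabilityMeasure_nextLaw hπ h _

/-- The state at step `h` is produced by earlier decisions only. This is why the contexts in the
iteration for step `h` still have the law induced by the guide. -/
theorem stateLaw_congr {π π' : Policy S K} {h : ℕ} (he : ∀ i < h, π i = π' i) :
    M.stateLaw π h = M.stateLaw π' h := by
  induction h with
  | zero => rfl
  | succ h ih =>
    have e : M.stepLaw π h = M.stepLaw π' h := by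
      funext s; simp only [stepLaw, he h (by omega)]
    rw [stateLaw_succ, stateLaw_succ, nextLaw, nextLaw, e, ih fun i hi => he i (by omega)]

/-- Peel off the first step: at coordinate `0` the remaining rollout has total mass one, and at a
later coordinate the rollout restarts from the law of the next state. -/
theorem lintegral_rollout_coord {π : Policy S K} (hπ : IsPolicy π) {F : Step S K → ℝ≥0∞}
    (hF : Measurable F) (n h : ℕ) (ν : Measure S) [IsProbabilityMeasure ν] (i : Fin n) :
    ∫⁻ τ, F (τ i) ∂ν.bind (M.rollout π n h)
      = ∫⁻ s, ∫⁻ x, F x ∂M.stepLaw π (h + i) s ∂M.stateLawFrom π h ν i := by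
  induction n generalizing h ν with
  | zero => exact i.elim0
  | succ n ih =>
    have hFi : ∀ {m : ℕ} (j : Fin m), Measurable fun τ : Traj S K m => F (τ j) :=
      fun j => hF.comp (measurable_pi_apply j)
    rw [Measure.lintegral_bind (measurable_rollout hπ _ _).aemeasurable (hFi i).aemeasurable]
    simp_rw [lintegral_rollout_succ hπ n h _ (hFi i)]
    refine Fin.cases ?_ (fun i => ?_) i
    · refine lintegral_congr fun s => lintegral_congr fun x => ?_
      have := isProbabilityMeasure_rollout (M := M) hπ n (h + 1) x.2.2.2
      simp
    · have := isProbabilityMeasure_nextLaw (M := M) hπ h ν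
      have key := ih (h + 1) (M.nextLaw π h ν) i
      rw [← stateLawFrom_succ, Measure.lintegral_bind (measurable_rollout hπ _ _).aemeasurable
        (hFi i).aemeasurable, nextLaw, lintegral_map, Measure.lintegral_bind] at key
      · simp only [Fin.cons_succ, Fin.val_succ]
        rw [key, Nat.add_right_comm h 1 i]
        rfl
      · exact (measurable_stepLaw hπ h).aemeasurable
      · exact ((Measure.measurable_lintegral (hFi i)).comp
          ((measurable_rollout hπ n (h + 1)).comp (by fun_prop))).aemeasurable
      · exact (Measure.measurable_lintegral (hFi i)).comp (measurable_rollout hπ n (h + 1))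
      · fun_prop

theorem lintegral_trajLaw_coord {π : Policy S K} (hπ : IsPolicy π) {F : S → Fin K → ℝ≥0∞}
    (hF : Measurable fun x : S × Fin K => F x.1 x.2) {H : ℕ} (h : Fin H) :
    ∫⁻ τ, F (τ h).1 (τ h).2.1 ∂M.trajLaw H π
      = ∫⁻ s, ∑ a, ENNReal.ofReal (π h s a) * F s a ∂M.stateLaw π h := by
  have hm : Measurable fun x : Step S K => F x.1 x.2.1 :=
    hF.comp (measurable_fst.prodMk (measurable_fst.comp measurable_snd))
  refine (lintegral_rollout_coord hπ hm H 0 M.init h).trans ?_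
  simp_rw [lintegral_stepLaw _ _ _ _ hm, Nat.zero_add]
  refine lintegral_congr fun s => Finset.sum_congr rfl fun a _ => ?_
  simp

theorem occupancy_eq_stateLaw {π : Policy S K} (hπ : IsPolicy π) {H : ℕ} (h : Fin H) :
    M.occupancy H π h = M.stateLaw π h := by
  have hm : Measurable fun τ : Traj S K H => (τ h).1 :=
    measurable_fst.comp (measurable_pi_apply h)
  ext A hA
  have key := lintegral_trajLaw_coord (M := M) hπ (F := fun s _ => A.indicator 1 s)
    ((measurable_one.indicator hA).comp measurable_fst) h
  rw [occupancy, Measure.map_apply hm hA, ← lintegral_indicator_one (hm hA),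
    ← lintegral_indicator_one hA]
  refine key.trans (lintegral_congr fun s => ?_)
  rw [← Finset.sum_mul, hπ.sum_ofReal, one_mul]

end MDP

end Laws

/-! ### The greedy action -/

section Greedy

variable {K : ℕ} [NeZero K]

theorem le_apply_greedy (f : Fin K → ℝ) (b : Fin K) : f b ≤ f (greedy f) := by
  have h := Finset.min'_mem (Finset.univ.filter fun a => ∀ b, f b ≤ f a) (by
    obtain ⟨a, ha⟩ := Finite.exists_max f
    exact ⟨a, by simpa using ha⟩)
  exact (Finset.mem_filter.1 h).2 b

/-- Describes the tie-broken maximizer by finitely many comparisons, which gives measurability of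
`greedy`. -/
theorem greedy_eq_iff (f : Fin K → ℝ) (a : Fin K) :
    greedy f = a ↔ (∀ b, f b ≤ f a) ∧ ∀ c < a, ¬ ∀ b, f b ≤ f c := by
  constructor
  · rintro rfl
    refine ⟨le_apply_greedy f, fun c hc hf => ?_⟩
    exact absurd (Finset.min'_le _ c (by simpa using hf)) (not_le.2 hc)
  · rintro ⟨h1, h2⟩
    refine le_antisymm (Finset.min'_le _ a (by simpa using h1)) ?_
    by_contra hlt
    exact h2 _ (not_le.1 hlt) (le_apply_greedy f)

theorem measurable_greedy : Measurable (greedy : (Fin K → ℝ) → Fin K) := by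
  refine measurable_to_countable' fun a => ?_
  have e : greedy ⁻¹' {a} = {f : Fin K → ℝ | (∀ b, f b ≤ f a) ∧ ∀ c < a, ¬ ∀ b, f b ≤ f c} := by
    ext f; exact greedy_eq_iff f a
  rw [e]
  measurability

/-- The loss of action `a` against the best action. -/
def actionGap (f : Fin K → ℝ) (a : Fin K) : ℝ := f (greedy f) - f a

theorem actionGap_nonneg (f : Fin K → ℝ) (a : Fin K) : 0 ≤ actionGap f a :=
  sub_nonneg.2 (le_apply_greedy f a)

theorem measurable_actionGap (a : Fin K) : Measurable fun f : Fin K → ℝ => actionGap f a := by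
  have h : Measurable fun p : (Fin K → ℝ) × Fin K => p.1 p.2 :=
    measurable_from_prod_countable_left fun b => measurable_pi_apply b
  exact (h.comp (measurable_id.prodMk measurable_greedy)).sub (measurable_pi_apply a)

end Greedy

/-! ### Values -/

section Values

variable {S Ω : Type*} [MeasurableSpace S] [MeasurableSpace Ω] {K : ℕ}

theorem integrable_of_abs_le {α : Type*} [MeasurableSpace α] {μ : Measure α} [IsFiniteMeasure μ]
    {f : α → ℝ} (hf : Measurable f) {c : ℝ} (hc : ∀ x, |f x| ≤ c) : Integrable f μ :=
  .of_bound hf.aestronglyMeasurable c (.of_forall hc)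

namespace MDP

variable {M : MDP S K}

theorem ae_reward_stepLaw (π : Policy S K) (h : ℕ) (s : S) :
    ∀ᵐ x ∂M.stepLaw π h s, x.2.2.1 ∈ Set.Icc (0 : ℝ) 1 := by
  have hm : MeasurableSet {x : Step S K | ¬ x.2.2.1 ∈ Set.Icc (0 : ℝ) 1} :=
    ((by fun_prop : Measurable fun x : Step S K => x.2.2.1) measurableSet_Icc).compl
  rw [ae_iff, ← lintegral_indicator_one hm,
    M.lintegral_stepLaw _ _ _ (measurable_one.indicator hm)]
  refine Finset.sum_eq_zero fun a _ => ?_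
  have h1 : ∀ᵐ y ∂(M.reward h (s, a)).prod (M.trans h (s, a)), y.1 ∈ Set.Icc (0 : ℝ) 1 :=
    Measure.quasiMeasurePreserving_fst.ae (M.reward_mem h (s, a))
  rw [lintegral_congr_ae (g := fun _ => 0), lintegral_zero, mul_zero]
  filter_upwards [h1] with y hy
  exact Set.indicator_of_notMem (by simpa using hy) _

theorem ae_reward_rollout {π : Policy S K} (hπ : IsPolicy π) (n h : ℕ) (s : S) :
    ∀ᵐ τ ∂M.rollout π n h s, ∀ i, (τ i).2.2.1 ∈ Set.Icc (0 : ℝ) 1 := by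
  induction n generalizing h s with
  | zero => exact .of_forall fun τ i => i.elim0
  | succ n ih =>
    have hm : MeasurableSet {τ : Traj S K (n + 1) | ∀ i, (τ i).2.2.1 ∈ Set.Icc (0 : ℝ) 1} := by
      simp only [Set.ofPred_forall]
      exact .iInter fun i => (by fun_prop : Measurable fun τ : Traj S K (n + 1) =>
        (τ i).2.2.1) measurableSet_Icc
    refine ae_bind_of_forall (measurable_rollout_cons hπ n (h + 1)) hm ?_
    filter_upwards [ae_reward_stepLaw π h s] with x hx
    have hc : Measurable fun τ : Traj S K n => Fin.cons (α := fun _ => Step S K) x τ :=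
      measurable_cons.comp measurable_prodMk_left
    rw [ae_map_iff hc.aemeasurable hm]
    filter_upwards [ih (h + 1) x.2.2.2] with τ hτ i
    refine Fin.cases ?_ (fun i => ?_) i
    · simpa using hx
    · simpa using hτ i

theorem measurable_return (n : ℕ) :
    Measurable fun τ : Traj S K n => ∑ i, (τ i).2.2.1 := by fun_prop

theorem ae_return {π : Policy S K} (hπ : IsPolicy π) (n h : ℕ) (s : S) :
    ∀ᵐ τ ∂M.rollout π n h s, 0 ≤ ∑ i, (τ i).2.2.1 ∧ ∑ i, (τ i).2.2.1 ≤ (n : ℝ) := by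
  filter_upwards [ae_reward_rollout hπ n h s] with τ hτ
  refine ⟨Finset.sum_nonneg fun i _ => (hτ i).1, ?_⟩
  simpa using Finset.sum_le_sum fun i (_ : i ∈ Finset.univ) => (hτ i).2

theorem integrable_return {π : Policy S K} (hπ : IsPolicy π) (n h : ℕ) (s : S) :
    Integrable (fun τ : Traj S K n => ∑ i, (τ i).2.2.1) (M.rollout π n h s) := by
  have := isProbabilityMeasure_rollout (M := M) hπ n h s
  refine .of_bound (measurable_return n).aestronglyMeasurable n ?_
  filter_upwards [ae_return hπ n h s] with τ hτ
  rw [Real.norm_eq_abs, abs_of_nonneg hτ.1]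
  exact hτ.2

theorem integral_return_mem {π : Policy S K} (hπ : IsPolicy π) (n h : ℕ) (s : S) :
    ∫ τ, ∑ i, (τ i).2.2.1 ∂M.rollout π n h s ∈ Set.Icc (0 : ℝ) n := by
  have := isProbabilityMeasure_rollout (M := M) hπ n h s
  constructor
  · exact integral_nonneg_of_ae ((ae_return hπ n h s).mono fun τ hτ => hτ.1)
  · refine (integral_mono_ae (integrable_return hπ n h s) (integrable_const (n : ℝ))
      ((ae_return hπ n h s).mono fun τ hτ => hτ.2)).trans ?_
    simp

theorem measurable_V_family {π : Ω → Policy S K} (hπ : IsPolicyFamily π) (H h : ℕ) :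
    Measurable fun p : Ω × S => M.V H (π p.1) h p.2 :=
  measurable_integral_prod (measurable_rollout_family hπ _ _)
    (fun _ => isProbabilityMeasure_rollout (hπ.isPolicy _) _ _ _)
    ((measurable_return _).comp measurable_snd)

theorem measurable_V {π : Policy S K} (hπ : IsPolicy π) (H h : ℕ) : Measurable (M.V H π h) :=
  (measurable_V_family (M := M) hπ.family H h).comp (measurable_prodMk_left (x := ()))

theorem V_mem {π : Policy S K} (hπ : IsPolicy π) (H h : ℕ) (s : S) :
    M.V H π h s ∈ Set.Icc (0 : ℝ) ((H - h : ℕ) : ℝ) :=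
  integral_return_mem hπ _ _ _

theorem abs_V_le {π : Policy S K} (hπ : IsPolicy π) (H h : ℕ) (s : S) : |M.V H π h s| ≤ H := by
  obtain ⟨h1, h2⟩ := V_mem (M := M) hπ H h s
  rw [abs_of_nonneg h1]
  exact h2.trans (by exact_mod_cast Nat.sub_le _ _)

theorem abs_V_sub_le {π π' : Policy S K} (hπ : IsPolicy π) (hπ' : IsPolicy π') (H h : ℕ) (s : S) :
    |M.V H π' h s - M.V H π h s| ≤ H + H :=
  (abs_sub _ _).trans (add_le_add (abs_V_le hπ' H h s) (abs_V_le hπ H h s))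

theorem V_horizon (π : Policy S K) (H : ℕ) (s : S) : M.V H π H s = 0 := by
  have : IsEmpty (Fin (H - H)) := by rw [Nat.sub_self]; infer_instance
  simp [V]

theorem measurable_Q_family {π : Ω → Policy S K} (hπ : IsPolicyFamily π) (H h : ℕ) (a : Fin K) :
    Measurable fun p : Ω × S => M.Q H (π p.1) h p.2 a := by
  refine Measurable.add ?_ ?_
  · exact measurable_integral_prod (f := fun p : Ω × S => M.reward h (p.2, a))
      (g := fun _ r => r)
      ((M.reward h).measurable.comp (measurable_snd.prodMk measurable_const))
      (fun p => inferInstance) measurable_snd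
  · exact measurable_integral_prod (f := fun p : Ω × S => M.trans h (p.2, a))
      (g := fun p s' => M.V H (π p.1) (h + 1) s')
      ((M.trans h).measurable.comp (measurable_snd.prodMk measurable_const))
      (fun p => inferInstance) ((measurable_V_family hπ H (h + 1)).comp
        ((measurable_fst.comp measurable_fst).prodMk measurable_snd))

theorem measurable_Q {π : Policy S K} (hπ : IsPolicy π) (H h : ℕ) (a : Fin K) :
    Measurable fun s => M.Q H π h s a :=
  (measurable_Q_family (M := M) hπ.family H h a).comp (measurable_prodMk_left (x := ()))

theorem integrable_reward (h : ℕ) (x : S × Fin K) : Integrable (fun r : ℝ => r) (M.reward h x) := by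
  refine .of_bound measurable_id.aestronglyMeasurable 1 ?_
  filter_upwards [M.reward_mem h x] with r hr
  rw [Real.norm_eq_abs, abs_of_nonneg hr.1]
  exact hr.2

theorem integrable_V {π : Policy S K} (hπ : IsPolicy π) (H h : ℕ) (μ : Measure S)
    [IsFiniteMeasure μ] : Integrable (M.V H π h) μ :=
  integrable_of_abs_le (measurable_V hπ H h) (abs_V_le hπ H h)

theorem Q_mem {π : Policy S K} (hπ : IsPolicy π) {H h : ℕ} (hh : h < H) (s : S) (a : Fin K) :
    M.Q H π h s a ∈ Set.Icc (0 : ℝ) H := by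
  have h1 : 0 ≤ ∫ r, r ∂M.reward h (s, a) :=
    integral_nonneg_of_ae ((M.reward_mem h (s, a)).mono fun r hr => hr.1)
  have h2 : ∫ r, r ∂M.reward h (s, a) ≤ 1 := by
    refine (integral_mono_ae (integrable_reward h (s, a)) (integrable_const (1 : ℝ))
      ((M.reward_mem h (s, a)).mono fun r hr => hr.2)).trans ?_
    simp
  have h3 : 0 ≤ ∫ s', M.V H π (h + 1) s' ∂M.trans h (s, a) :=
    integral_nonneg fun s' => (V_mem hπ H (h + 1) s').1
  have h4 : ∫ s', M.V H π (h + 1) s' ∂M.trans h (s, a) ≤ ((H - (h + 1) : ℕ) : ℝ) := by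
    refine (integral_mono (integrable_V hπ H (h + 1) _) (integrable_const _)
      fun s' => (V_mem hπ H (h + 1) s').2).trans ?_
    simp
  have h5 : ((H - (h + 1) : ℕ) : ℝ) = H - (h + 1) := by
    rw [Nat.cast_sub (by omega)]; push_cast; ring
  have h6 : (0 : ℝ) ≤ h := Nat.cast_nonneg h
  constructor
  · exact add_nonneg h1 h3
  · exact (add_le_add h2 h4).trans (by rw [h5]; linarith)

theorem rollout_congr {π π' : Policy S K} (n h : ℕ) (he : ∀ i, h ≤ i → π i = π' i) (s : S) :
    M.rollout π n h s = M.rollout π' n h s := by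
  induction n generalizing h s with
  | zero => rfl
  | succ n ih =>
    have h1 : M.stepLaw π h s = M.stepLaw π' h s := by simp only [stepLaw, he h le_rfl]
    have h2 : M.rollout π n (h + 1) = M.rollout π' n (h + 1) :=
      funext fun s => ih (h + 1) (fun i hi => he i (by omega)) s
    rw [rollout, rollout, h1, h2]

theorem V_congr {π π' : Policy S K} (H h : ℕ) (he : ∀ i, h ≤ i → π i = π' i) (s : S) :
    M.V H π h s = M.V H π' h s := by
  rw [V, V, rollout_congr _ h he]

theorem Q_congr {π π' : Policy S K} (H h : ℕ) (he : ∀ i, h < i → π i = π' i) (s : S) (a : Fin K) :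
    M.Q H π h s a = M.Q H π' h s a := by
  have : M.V H π (h + 1) = M.V H π' (h + 1) := funext fun s => V_congr H (h + 1) he s
  rw [Q, Q, this]

theorem integral_stepLaw {π : Policy S K} (hπ : IsPolicy π) (h : ℕ) (s : S) {F : Step S K → ℝ}
    (hF : Measurable F) (hi : ∀ a, Integrable (fun y : ℝ × S => F (s, a, y.1, y.2))
      ((M.reward h (s, a)).prod (M.trans h (s, a)))) :
    ∫ x, F x ∂M.stepLaw π h s = ∑ a, π h s a *
      ∫ y, F (s, a, y.1, y.2) ∂(M.reward h (s, a)).prod (M.trans h (s, a)) := by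
  rw [stepLaw, integral_finsetSum_measure]
  · refine Finset.sum_congr rfl fun a _ => ?_
    rw [integral_smul_measure, integral_map (measurable_mkStep s a).aemeasurable
      hF.aestronglyMeasurable, smul_eq_mul, ENNReal.toReal_ofReal (hπ.nonneg h s a)]
  · intro a _
    refine Integrable.smul_measure ?_ ENNReal.ofReal_ne_top
    rw [integrable_map_measure hF.aestronglyMeasurable (measurable_mkStep s a).aemeasurable]
    exact hi a

/-- Condition the return on the first step: the reward contributes its mean, the remaining rollout
contributes the next value. -/
theorem V_bellman {π : Policy S K} (hπ : IsPolicy π) {H h : ℕ} (hh : h < H) (s : S) :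
    M.V H π h s = ∑ a, π h s a * M.Q H π h s a := by
  obtain ⟨n, hn⟩ : ∃ n, H - h = n + 1 := ⟨H - h - 1, by omega⟩
  have hn' : H - (h + 1) = n := by omega
  have hstep := isProbabilityMeasure_stepLaw (M := M) hπ h s
  have hV : ∀ s', M.V H π (h + 1) s' = ∫ τ, ∑ i, (τ i).2.2.1 ∂M.rollout π n (h + 1) s' :=
    fun s' => by rw [V, hn']
  have h1 : M.V H π h s = ∫ x, x.2.2.1 + M.V H π (h + 1) x.2.2.2 ∂M.stepLaw π h s := by
    rw [V, hn]
    have hint := integrable_return (M := M) hπ (n + 1) h s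
    rw [rollout] at hint ⊢
    have hc : ∀ x : Step S K, Measurable fun τ : Traj S K n =>
        Fin.cons (α := fun _ => Step S K) x τ :=
      fun x => measurable_cons.comp measurable_prodMk_left
    rw [integral_bind_of_integrable (measurable_rollout_cons hπ n (h + 1)) (fun x => by
      have := isProbabilityMeasure_rollout (M := M) hπ n (h + 1) x.2.2.2
      exact Measure.isProbabilityMeasure_map (hc x).aemeasurable) hint]
    refine integral_congr_ae (.of_forall fun x => ?_)
    have := isProbabilityMeasure_rollout (M := M) hπ n (h + 1) x.2.2.2
    simp only
    rw [integral_map (hc x).aemeasurable (measurable_return _).aestronglyMeasurable]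
    simp only [Fin.sum_univ_succ, Fin.cons_zero, Fin.cons_succ]
    rw [integral_add (integrable_const _) (integrable_return hπ n (h + 1) _), hV]
    simp
  have hVm := measurable_V (M := M) hπ H (h + 1)
  rw [h1, integral_stepLaw hπ h s (by fun_prop)]
  · refine Finset.sum_congr rfl fun a _ => ?_
    rw [integral_add ((integrable_reward h (s, a)).comp_fst _)
      ((integrable_V hπ H (h + 1) _).comp_snd _),
      integral_fun_fst (fun r : ℝ => r), integral_fun_snd (M.V H π (h + 1))]
    simp [Q]
  · intro a
    exact ((integrable_reward h (s, a)).comp_fst _).add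
      ((integrable_V hπ H (h + 1) _).comp_snd _)

/-! ### Performance difference -/

section Regret

variable [NeZero K]

variable (M) in
/-- Expected one-step loss of `π` at step `h` against the greedy action for its own values. -/
def regret (H : ℕ) (π : Policy S K) (h : ℕ) (s : S) : ℝ :=
  ∑ a, π h s a * actionGap (M.Q H π h s) a

theorem regret_nonneg {π : Policy S K} (hπ : IsPolicy π) (H h : ℕ) (s : S) :
    0 ≤ M.regret H π h s :=
  Finset.sum_nonneg fun a _ => mul_nonneg (hπ.nonneg h s a) (actionGap_nonneg _ a)

theorem measurable_regret_family {π : Ω → Policy S K} (hπ : IsPolicyFamily π) (H h : ℕ) :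
    Measurable fun p : Ω × S => M.regret H (π p.1) h p.2 :=
  Finset.measurable_fun_sum _ fun a _ => (hπ.measurable h a).mul
    ((measurable_actionGap a).comp (measurable_pi_iff.2 fun b => measurable_Q_family hπ H h b))

theorem measurable_regret {π : Policy S K} (hπ : IsPolicy π) (H h : ℕ) :
    Measurable (M.regret H π h) :=
  (measurable_regret_family (M := M) hπ.family H h).comp (measurable_prodMk_left (x := ()))

theorem regret_eq {π : Policy S K} (hπ : IsPolicy π) {H h : ℕ} (hh : h < H) (s : S) :
    M.regret H π h s = M.Q H π h s (greedy (M.Q H π h s)) - M.V H π h s := by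
  rw [V_bellman hπ hh, regret]
  simp only [actionGap, mul_sub, Finset.sum_sub_distrib, ← Finset.sum_mul, hπ.sum_eq_one, one_mul]

theorem abs_regret_le {π : Policy S K} (hπ : IsPolicy π) {H h : ℕ} (hh : h < H) (s : S) :
    |M.regret H π h s| ≤ H := by
  rw [abs_of_nonneg (regret_nonneg hπ H h s), regret_eq hπ hh]
  have h1 := (Q_mem (M := M) hπ hh s (greedy (M.Q H π h s))).2
  have h2 := (V_mem (M := M) hπ H h s).1
  linarith

/-- Insert `Q^π` under the actions of `π'`. The difference `Q^{π'} - Q^π` is the expected value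
difference at the next state, and the mean of `Q^π` under `π'` exceeds `V^π` by at most the regret
of `π`, since a mean is at most the maximum. -/
theorem integral_V_sub_le {π π' : Policy S K} (hπ : IsPolicy π) (hπ' : IsPolicy π') {H h : ℕ}
    (hh : h < H) (ν : Measure S) [IsProbabilityMeasure ν] :
    ∫ s, (M.V H π' h s - M.V H π h s) ∂ν ≤ ∫ s, M.regret H π h s ∂ν
      + ∫ s, (M.V H π' (h + 1) s - M.V H π (h + 1) s) ∂M.nextLaw π' h ν := by
  set D : S → ℝ := fun s => M.V H π' (h + 1) s - M.V H π (h + 1) s with hD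
  have hDm : Measurable D := (measurable_V hπ' H (h + 1)).sub (measurable_V hπ H (h + 1))
  have hDb : ∀ s, |D s| ≤ H + H := abs_V_sub_le hπ hπ' H (h + 1)
  have hmeas := measurable_stepLaw (M := M) hπ' h
  have hprob := isProbabilityMeasure_stepLaw (M := M) hπ' h
  have hbind := isProbabilityMeasure_bind_of_measurable (μ := ν) hmeas hprob
  have hDx : Measurable fun x : Step S K => D x.2.2.2 := by fun_prop
  have hDi : ∀ s, |∫ x, D x.2.2.2 ∂M.stepLaw π' h s| ≤ H + H := fun s => by
    simpa using norm_integral_le_of_norm_le_const (μ := M.stepLaw π' h s)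
      (f := fun x => D x.2.2.2) (.of_forall fun x => hDb x.2.2.2)
  have hnext : ∫ s, D s ∂M.nextLaw π' h ν
      = ∫ s, ∫ x, D x.2.2.2 ∂M.stepLaw π' h s ∂ν := by
    rw [nextLaw, integral_map (by fun_prop) hDm.aestronglyMeasurable,
      integral_bind_of_integrable hmeas hprob (integrable_of_abs_le hDx fun x => hDb _)]
  have hstep : ∀ s, ∫ x, D x.2.2.2 ∂M.stepLaw π' h s
      = ∑ a, π' h s a * (M.Q H π' h s a - M.Q H π h s a) := fun s => by
    rw [integral_stepLaw hπ' h s hDx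
      fun a => (integrable_of_abs_le (μ := M.trans h (s, a)) hDm hDb).comp_snd _]
    refine Finset.sum_congr rfl fun a _ => ?_
    rw [integral_fun_snd D, Q, Q, hD,
      integral_sub (integrable_V hπ' H (h + 1) _) (integrable_V hπ H (h + 1) _)]
    simp
  rw [hnext, ← integral_add]
  · refine integral_mono (integrable_of_abs_le ?_ (abs_V_sub_le hπ hπ' H h)) ?_ fun s => ?_
    · exact (measurable_V hπ' H h).sub (measurable_V hπ H h)
    · refine (integrable_of_abs_le (measurable_regret hπ H h) (abs_regret_le hπ hh)).add ?_
      refine integrable_of_abs_le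
        (measurable_integral_prod hmeas hprob (hDx.comp measurable_snd)) hDi
    · simp only
      rw [hstep, regret_eq hπ hh, V_bellman hπ' hh]
      have : ∑ a, π' h s a * M.Q H π h s a ≤ M.Q H π h s (greedy (M.Q H π h s)) := by
        rw [← one_mul (M.Q H π h s (greedy (M.Q H π h s))), ← hπ'.sum_eq_one h s, Finset.sum_mul]
        exact Finset.sum_le_sum fun a _ =>
          mul_le_mul_of_nonneg_left (le_apply_greedy _ a) (hπ'.nonneg h s a)
      simp only [mul_sub, Finset.sum_sub_distrib]
      linarith
  · exact integrable_of_abs_le (measurable_regret hπ H h) (abs_regret_le hπ hh)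
  · refine integrable_of_abs_le
        (measurable_integral_prod hmeas hprob (hDx.comp measurable_snd)) hDi

/-- Telescope the one-step inequality along the states visited by `π'`; the values vanish at the
horizon. -/
theorem gap_le_sum_regret {π π' : Policy S K} (hπ : IsPolicy π) (hπ' : IsPolicy π') (H : ℕ) :
    M.gap H π' π ≤ ∑ h ∈ Finset.range H, ∫ s, M.regret H π h s ∂M.stateLaw π' h := by
  have key : ∀ k ≤ H, M.gap H π' π ≤ ∑ h ∈ Finset.range k, ∫ s, M.regret H π h s ∂M.stateLaw π' h
      + ∫ s, (M.V H π' k s - M.V H π k s) ∂M.stateLaw π' k := by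
    intro k
    induction k with
    | zero => intro _; simp [gap, stateLaw, stateLawFrom]
    | succ k ih =>
      intro hk
      have := isProbabilityMeasure_stateLaw (M := M) hπ' k
      have h1 := integral_V_sub_le (M := M) hπ hπ' (by omega : k < H) (M.stateLaw π' k)
      rw [← stateLaw_succ] at h1
      rw [Finset.sum_range_succ]
      linarith [ih (by omega)]
  simpa [V_horizon] using key H le_rfl

/-- Coverage compares only the laws of `φ(s_h)`. It applies because the regret factors through `φ`,
and nonnegativity allows the domination of measures to pass to the integrals. -/
theorem ofReal_gap_le {X : Type*} [MeasurableSpace X] {φ : S → X} (hφ : Measurable φ)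
    {π π' πg : Policy S K} (hπ : IsPolicy π) (hπ' : IsPolicy π') (hπg : IsPolicy πg) {H : ℕ}
    {C : ℝ≥0} (hC : M.Covers H φ πg π' C)
    (hf : ∀ h < H, ∃ g : X → ℝ, Measurable g ∧ ∀ s, M.regret H π h s = g (φ s)) :
    ENNReal.ofReal (M.gap H π' π) ≤
      C * ∑ h ∈ Finset.range H, ∫⁻ s, ENNReal.ofReal (M.regret H π h s) ∂M.stateLaw πg h := by
  refine (ENNReal.ofReal_le_ofReal (gap_le_sum_regret hπ hπ' H)).trans ?_
  rw [ENNReal.ofReal_sum_of_nonneg fun h _ => integral_nonneg fun s => regret_nonneg hπ H h s,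
    Finset.mul_sum]
  refine Finset.sum_le_sum fun h hh => ?_
  have hh := Finset.mem_range.1 hh
  have := isProbabilityMeasure_stateLaw (M := M) hπ' h
  rw [ofReal_integral_eq_lintegral_ofReal
    (integrable_of_abs_le (measurable_regret hπ H h) (abs_regret_le hπ hh))
    (.of_forall fun s => regret_nonneg hπ H h s)]
  obtain ⟨g, hg, hge⟩ := hf h hh
  have e : ∀ ν : Measure S, ∫⁻ s, ENNReal.ofReal (M.regret H π h s) ∂ν
      = ∫⁻ x, ENNReal.ofReal (g x) ∂ν.map φ := fun ν => by
    rw [lintegral_map hg.ennreal_ofReal hφ]; simp_rw [hge]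
  have hc := hC ⟨h, hh⟩
  rw [occupancy_eq_stateLaw hπ', occupancy_eq_stateLaw hπg] at hc
  rw [e, e]
  refine (lintegral_mono' hc le_rfl).trans (le_of_eq ?_)
  exact lintegral_smul_measure (C : ℝ≥0∞) _

theorem regret_dependsOnFeature {X : Type*} [MeasurableSpace X] {φ : S → X} {π : Policy S K}
    {H h : ℕ} (hπφ : IsFeaturePolicy φ π)
    (hQ : ∀ a, DependsOnFeature φ fun s => M.Q H π h s a) :
    ∃ g : X → ℝ, Measurable g ∧ ∀ s, M.regret H π h s = g (φ s) := by
  choose p hpm hp using hπφ h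
  choose q hqm hq using hQ
  refine ⟨fun x => ∑ a, p a x * actionGap (fun b => q b x) a, ?_, fun s => ?_⟩
  · exact Finset.measurable_fun_sum _ fun a _ => (hpm a).mul
      ((measurable_actionGap a).comp (measurable_pi_iff.2 hqm))
  · have : M.Q H π h s = fun b => q b (φ s) := funext fun b => hq b s
    simp only [regret, hp, this]

end Regret

end MDP

end Values

/-! ### Inverse gap weighting -/

section InvGap

variable {K : ℕ} [NeZero K]

theorem card_pos : (0 : ℝ) < K := by exact_mod_cast Nat.pos_of_ne_zero (NeZero.ne K)

theorem actionGap_greedy (f : Fin K → ℝ) : actionGap f (greedy f) = 0 := sub_self _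

theorem invGap_of_ne {γ : ℝ} {f : Fin K → ℝ} {a : Fin K} (ha : a ≠ greedy f) :
    invGap γ f a = 1 / (K + γ * actionGap f a) := if_neg ha

theorem invGap_greedy (γ : ℝ) (f : Fin K → ℝ) : invGap γ f (greedy f)
    = 1 - ∑ b ∈ Finset.univ.erase (greedy f), invGap γ f b := by
  rw [invGap, if_pos rfl]
  congr 1
  exact Finset.sum_congr rfl fun b hb => (invGap_of_ne (Finset.ne_of_mem_erase hb)).symm

theorem sum_invGap (γ : ℝ) (f : Fin K → ℝ) : ∑ a, invGap γ f a = 1 := by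
  rw [← Finset.add_sum_erase _ _ (Finset.mem_univ (greedy f)), invGap_greedy]
  ring

theorem card_le_invGap_denom {γ : ℝ} (hγ : 0 ≤ γ) (f : Fin K → ℝ) (a : Fin K) :
    (K : ℝ) ≤ K + γ * actionGap f a :=
  le_add_of_nonneg_right (mul_nonneg hγ (actionGap_nonneg f a))

/-- Exploration guarantee. For a non-greedy action this is an equality; the `K - 1` others receive
at most `1/K` each, so at least `1/K` is left for the greedy one. -/
theorem one_le_mul_invGap {γ : ℝ} (hγ : 0 ≤ γ) (f : Fin K → ℝ) (a : Fin K) :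
    1 ≤ (K + γ * actionGap f a) * invGap γ f a := by
  have hK := card_pos (K := K)
  by_cases ha : a = greedy f
  · subst ha
    have h1 : ∑ b ∈ Finset.univ.erase (greedy f), invGap γ f b
        ≤ ∑ b ∈ Finset.univ.erase (greedy f), 1 / (K : ℝ) :=
      Finset.sum_le_sum fun b hb => by
        rw [invGap_of_ne (Finset.ne_of_mem_erase hb)]
        exact one_div_le_one_div_of_le hK (card_le_invGap_denom hγ f b)
    rw [Finset.sum_const, Finset.card_erase_of_mem (Finset.mem_univ _), Finset.card_univ,
      Fintype.card_fin, nsmul_eq_mul, Nat.cast_sub (Nat.pos_of_ne_zero (NeZero.ne K)),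
      Nat.cast_one] at h1
    rw [actionGap_greedy, mul_zero, add_zero, invGap_greedy]
    have h2 : (K : ℝ) * (((K : ℝ) - 1) * (1 / K)) = K - 1 := by field_simp
    nlinarith [mul_le_mul_of_nonneg_left h1 hK.le]
  · rw [invGap_of_ne ha, mul_one_div_cancel]
    exact (hK.trans_le (card_le_invGap_denom hγ f a)).ne'

theorem invGap_nonneg {γ : ℝ} (hγ : 0 ≤ γ) (f : Fin K → ℝ) (a : Fin K) : 0 ≤ invGap γ f a := by
  have h1 := card_pos.trans_le (card_le_invGap_denom hγ f a)
  exact (pos_of_mul_pos_right (one_pos.trans_le (one_le_mul_invGap hγ f a)) h1.le).le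

/-- Exploitation guarantee: each action costs at most `gap / (K + γ · gap) ≤ 1/γ`, and the greedy
one costs nothing. -/
theorem sum_invGap_mul_actionGap_le {γ : ℝ} (hγ : 0 < γ) (f : Fin K → ℝ) :
    ∑ a, invGap γ f a * actionGap f a ≤ K / γ := by
  have h : ∀ a, invGap γ f a * actionGap f a ≤ 1 / γ := fun a => by
    by_cases ha : a = greedy f
    · rw [ha, actionGap_greedy, mul_zero]
      positivity
    · have h1 := card_pos.trans_le (card_le_invGap_denom hγ.le f a)
      rw [invGap_of_ne ha, one_div_mul_eq_div, div_le_div_iff₀ h1 hγ]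
      have := card_pos (K := K)
      linarith
  refine (Finset.sum_le_sum fun a _ => h a).trans ?_
  simp [div_eq_mul_inv]

theorem measurable_invGap (γ : ℝ) (a : Fin K) : Measurable fun f : Fin K → ℝ => invGap γ f a := by
  -- The index set of the sum in `invGap` depends on `f` through `greedy f`; indicators turn it into
  -- a sum over a fixed set.
  have e : (fun f : Fin K → ℝ => invGap γ f a) = fun f => if greedy f = a then
      1 - ∑ b, (if b = greedy f then 0 else 1 / (K + γ * actionGap f b))
      else 1 / (K + γ * actionGap f a) := by
    funext f
    by_cases ha : a = greedy f
    · rw [if_pos ha.symm, ha, invGap_greedy,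
        ← Finset.add_sum_erase _ _ (Finset.mem_univ (greedy f)), if_pos rfl, zero_add]
      congr 1
      refine Finset.sum_congr rfl fun b hb => ?_
      have := Finset.ne_of_mem_erase hb
      rw [if_neg this, invGap_of_ne this]
    · rw [if_neg fun h => ha h.symm, invGap_of_ne ha]
  have hd : ∀ b, Measurable fun f : Fin K → ℝ => 1 / (K + γ * actionGap f b) := fun b =>
    measurable_const.div (measurable_const.add ((measurable_actionGap b).const_mul γ))
  have hs : ∀ b, MeasurableSet {f : Fin K → ℝ | b = greedy f} := fun b => by
    have := measurable_greedy (measurableSet_singleton b)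
    convert this using 1
    ext f
    exact eq_comm
  have hs' : MeasurableSet {f : Fin K → ℝ | greedy f = a} :=
    measurable_greedy (measurableSet_singleton a)
  rw [e]
  exact .ite hs' (measurable_const.sub (Finset.measurable_fun_sum _ fun b _ =>
    .ite (hs b) measurable_const (hd b))) (hd a)

/-- If the action gaps of `fo` are within a factor `2` and a slack `c` of those of `f`, then so are
those of a predictor `fn` fitted to `f` under inverse gap weighting with respect to `fo`. -/
theorem actionGap_comparison {f fo fn p : Fin K → ℝ} {γ c : ℝ} (hγ : 0 < γ)
    (hp : ∀ a, 0 ≤ p a) (hpe : ∀ a, 1 ≤ (K + γ * actionGap fo a) * p a)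
    (hc : ∀ a, actionGap f a ≤ 2 * actionGap fo a + c ∧ actionGap fo a ≤ 2 * actionGap f a + c)
    (a : Fin K) :
    actionGap f a ≤ 2 * actionGap fn a
        + (4 / 3 * (K / (4 * γ) + 4 * γ * ∑ b, p b * (fn b - f b) ^ 2) + c / 3) ∧
      actionGap fn a ≤ 2 * actionGap f a
        + (4 / 3 * (K / (4 * γ) + 4 * γ * ∑ b, p b * (fn b - f b) ^ 2) + c / 3) := by
  set δ := ∑ b, p b * (fn b - f b) ^ 2 with hδ
  have hK := card_pos (K := K)
  have hδ0 : 0 ≤ δ := Finset.sum_nonneg fun b _ => mul_nonneg (hp b) (sq_nonneg _)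
  -- The AM-GM weights are chosen so that the old gap enters the pointwise error with coefficient
  -- exactly `1/8`.
  set ε := K / (8 * γ) + 2 * γ * δ with hε
  have hε0 : 0 ≤ ε := by positivity
  have hb : K / (4 * γ) + 4 * γ * δ = 2 * ε := by rw [hε]; field_simp; ring
  have herr : ∀ b, |fn b - f b| ≤ ε + actionGap fo b / 8 := fun b => by
    set u := K + γ * actionGap fo b with hu
    have hu0 : 0 ≤ u := hK.le.trans (card_le_invGap_denom hγ.le fo b)
    have h1 : p b * (fn b - f b) ^ 2 ≤ δ :=
      Finset.single_le_sum (f := fun b => p b * (fn b - f b) ^ 2)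
        (fun b _ => mul_nonneg (hp b) (sq_nonneg _)) (Finset.mem_univ b)
    have h2 : (fn b - f b) ^ 2 ≤ u * δ := by
      have h3 := mul_le_mul_of_nonneg_right (hpe b) (sq_nonneg (fn b - f b))
      have h4 := mul_le_mul_of_nonneg_left h1 hu0
      rw [one_mul, mul_assoc] at h3
      exact h3.trans h4
    have h5 : ε + actionGap fo b / 8 = u / (8 * γ) + 2 * γ * δ := by
      rw [hε, hu]; field_simp; ring
    rw [h5]
    refine abs_le_of_sq_le_sq (h2.trans ?_) (by positivity)
    -- With `x = u / (8γ)` and `y = 2γδ` one has `u δ = 4xy ≤ (x + y)²`.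
    have h6 : u * δ = 4 * (u / (8 * γ)) * (2 * γ * δ) := by field_simp; ring
    rw [h6]
    nlinarith [sq_nonneg (u / (8 * γ) - 2 * γ * δ)]
  -- Compare the best action for `f` with `b`. The old gap of the former is at most `c`, that of `b`
  -- at most `2 · actionGap f b + c`. Moving the resulting quarter of `actionGap f b` to the left
  -- leaves the factor `3/4`, so the slack `c/4` becomes `c/3`.
  have key : ∀ b, actionGap f b ≤ actionGap fn b + 2 * ε + c / 8 + (2 * actionGap f b + c) / 8 :=
    fun b => by
      have h1 := abs_le.1 (herr (greedy f))
      have h2 := abs_le.1 (herr b)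
      have h3 := (hc (greedy f)).2
      have h4 := (hc b).2
      have h5 := le_apply_greedy fn (greedy f)
      rw [actionGap_greedy] at h3
      have h6 : actionGap f b = f (greedy f) - f b := rfl
      have h7 : actionGap fn b = fn (greedy fn) - fn b := rfl
      linarith
  have h0 := actionGap_nonneg f a
  have h0n := actionGap_nonneg fn a
  rw [hb]
  constructor
  · linarith [key a]
  -- Here the error at `greedy fn` brings in a quarter of the `f`-gap of that action; it is absorbed
  -- because the same gap also occurs with coefficient `-1`.
  · have h1 := abs_le.1 (herr (greedy fn))
    have h2 := abs_le.1 (herr a)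
    have h3 := (hc (greedy fn)).2
    have h4 := (hc a).2
    have h6 : actionGap f a = f (greedy f) - f a := rfl
    have h7 : actionGap fn a = fn (greedy fn) - fn a := rfl
    have h8 : actionGap f (greedy fn) = f (greedy f) - f (greedy fn) := rfl
    have h9 := actionGap_nonneg f (greedy fn)
    have h10 := (hc (greedy f)).2
    have h11 := actionGap_nonneg fo (greedy f)
    rw [actionGap_greedy] at h10
    linarith

end InvGap

/-! ### Epochs of FALCON+ -/

section Epochs

variable {S X : Type*} {K H : ℕ}

theorem epochEnd_le_succ (k : ℕ) : epochEnd k ≤ epochEnd (k + 1) := by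
  unfold epochEnd
  rcases k with _ | k
  · simp
  · simpa using Nat.pow_le_pow_right (by norm_num : 0 < 2) (Nat.le_succ (k + 1))

/-- The number of rounds of epoch `k`. -/
def epochLen (k : ℕ) : ℕ := epochEnd k - epochEnd (k - 1)

theorem epochEnd_add_epochLen (k : ℕ) : epochEnd k + epochLen (k + 1) = epochEnd (k + 1) :=
  Nat.add_sub_of_le (epochEnd_le_succ k)

theorem epochLen_le (k : ℕ) : epochLen k ≤ epochEnd k := Nat.sub_le _ _

theorem two_pow_le_epochLen (k : ℕ) : 2 ^ k ≤ epochLen (k + 1) := by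
  rcases k with _ | k
  · simp [epochLen, epochEnd]
  · simp only [epochLen, epochEnd, Nat.add_sub_cancel]
    rw [if_neg (by omega), if_neg (by omega), pow_succ 2 (k + 1)]
    omega

theorem epochLen_pos (k : ℕ) : 1 ≤ epochLen (k + 1) :=
  Nat.one_le_two_pow.trans (two_pow_le_epochLen k)

theorem epochLen_le_succ (k : ℕ) : epochLen (k + 1) ≤ epochLen (k + 2) := by
  refine le_trans ?_ (two_pow_le_epochLen (k + 1))
  refine (epochLen_le _).trans ?_
  simp [epochEnd]

/-- The learning rate that is used after epoch `k`. -/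
def epochRate (K : ℕ) (E : ℕ → ℝ) (k : ℕ) : ℝ :=
  if k = 0 then 1 else Real.sqrt (K / E (epochLen k)) / 2

/-- The predictor that is fitted to the trajectories of epoch `k`. -/
def epochPred (O : Oracle S X K H) (h k : ℕ) (D : Fin (epochEnd k) → Traj S K H) (x : X) :
    Fin K → ℝ :=
  if k = 0 then fun _ => 0
  else O (epochLen k) (fun j => D ⟨epochEnd (k - 1) + j, by
    have := j.2
    unfold epochLen at this
    omega⟩) h x

theorem epochRate_nonneg (E : ℕ → ℝ) (k : ℕ) : 0 ≤ epochRate K E k := by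
  unfold epochRate
  split_ifs
  · exact zero_le_one
  · positivity

/-- Epoch lengths do not decrease and `E` is nonincreasing. The conventional rate `1` at index `0`
is left out, as it need not be below the next rate. -/
theorem epochRate_le_succ {E : ℕ → ℝ} (hE : ∀ n, 1 ≤ n → 0 < E n)
    (hmono : ∀ m n : ℕ, 1 ≤ m → m ≤ n → E n ≤ E m) (k : ℕ) :
    epochRate K E (k + 1) ≤ epochRate K E (k + 2) := by
  unfold epochRate
  rw [if_neg (by omega), if_neg (by omega)]
  refine div_le_div_of_nonneg_right (Real.sqrt_le_sqrt ?_) two_pos.le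
  exact div_le_div_of_nonneg_left (Nat.cast_nonneg K) (hE _ (epochLen_pos _))
    (hmono _ _ (epochLen_pos k) (epochLen_le_succ k))

variable [NeZero K]

/-- The action distribution that is used after epoch `k`. -/
def epochAct (O : Oracle S X K H) (E : ℕ → ℝ) (h k : ℕ) (D : Fin (epochEnd k) → Traj S K H)
    (x : X) : Fin K → ℝ :=
  invGap (epochRate K E k) (epochPred O h k D x)

/-- The distribution in round `t` depends only on trajectories of completed epochs; this exposes it
as frozen within an epoch. -/
theorem falcon_eq_epochAct (O : Oracle S X K H) (E : ℕ → ℝ) (h t : ℕ)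
    (D : Fin t → Traj S K H) (x : X) :
    falcon O E h t D x = epochAct O E h (Nat.log 2 t)
      (fun j => D (Fin.castLE (epochEnd_log_le t) j)) x := by
  unfold falcon epochAct epochRate epochPred
  dsimp only
  split_ifs <;> rfl

theorem epochAct_nonneg (O : Oracle S X K H) (E : ℕ → ℝ) (h k : ℕ)
    (D : Fin (epochEnd k) → Traj S K H) (x : X) (a : Fin K) : 0 ≤ epochAct O E h k D x a :=
  invGap_nonneg (epochRate_nonneg E k) _ a

theorem sum_epochAct (O : Oracle S X K H) (E : ℕ → ℝ) (h k : ℕ)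
    (D : Fin (epochEnd k) → Traj S K H) (x : X) : ∑ a, epochAct O E h k D x a = 1 :=
  sum_invGap _ _

theorem falcon_nonneg (O : Oracle S X K H) (E : ℕ → ℝ) (h t : ℕ)
    (D : Fin t → Traj S K H) (x : X) (a : Fin K) : 0 ≤ falcon O E h t D x a := by
  rw [falcon_eq_epochAct]; exact epochAct_nonneg _ _ _ _ _ _ _

theorem sum_falcon (O : Oracle S X K H) (E : ℕ → ℝ) (h t : ℕ)
    (D : Fin t → Traj S K H) (x : X) : ∑ a, falcon O E h t D x a = 1 := by
  simp_rw [falcon_eq_epochAct]; exact sum_epochAct _ _ _ _ _ _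

/-- The slack with which the predictor fitted to epoch `k` has the same action gaps as `f`. -/
def slack (O : Oracle S X K H) (E : ℕ → ℝ) (φ : S → X) (f : S → Fin K → ℝ) (h : ℕ) :
    (k : ℕ) → (Fin (epochEnd k) → Traj S K H) → S → ℝ
  | 0, _, _ => H
  | k + 1, D, s =>
      4 / 3 * (K / (4 * epochRate K E (k + 1)) + 4 * epochRate K E (k + 1) *
        ∑ a, epochAct O E h k (fun j => D (Fin.castLE (epochEnd_le_succ k) j)) (φ s) a *
          (epochPred O h (k + 1) D (φ s) a - f s a) ^ 2)
      + slack O E φ f h k (fun j => D (Fin.castLE (epochEnd_le_succ k) j)) s / 3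

theorem slack_nonneg (O : Oracle S X K H) (E : ℕ → ℝ) (φ : S → X) (f : S → Fin K → ℝ) (h k : ℕ)
    (D : Fin (epochEnd k) → Traj S K H) (s : S) : 0 ≤ slack O E φ f h k D s := by
  induction k with
  | zero => exact Nat.cast_nonneg H
  | succ k ih =>
    have h1 := epochRate_nonneg (K := K) E (k + 1)
    have h2 := ih fun j => D (Fin.castLE (epochEnd_le_succ k) j)
    have h3 : 0 ≤ ∑ a, epochAct O E h k (fun j => D (Fin.castLE (epochEnd_le_succ k) j)) (φ s) a *
          (epochPred O h (k + 1) D (φ s) a - f s a) ^ 2 :=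
      Finset.sum_nonneg fun a _ => mul_nonneg (epochAct_nonneg _ _ _ _ _ _ _) (sq_nonneg _)
    rw [slack]
    positivity

theorem epochRate_pos {E : ℕ → ℝ} (hE : ∀ n, 1 ≤ n → 0 < E n) (k : ℕ) :
    0 < epochRate K E k := by
  unfold epochRate
  split_ifs with hk
  · exact one_pos
  · obtain ⟨j, rfl⟩ := Nat.exists_eq_succ_of_ne_zero hk
    have := hE _ (epochLen_pos j)
    have := card_pos (K := K)
    positivity

theorem epochPred_comparison (O : Oracle S X K H) {E : ℕ → ℝ} (hE : ∀ n, 1 ≤ n → 0 < E n)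
    (hmono : ∀ m n : ℕ, 1 ≤ m → m ≤ n → E n ≤ E m) (φ : S → X) {f : S → Fin K → ℝ}
    (hf : ∀ s a, f s a ∈ Set.Icc (0 : ℝ) H) (h k : ℕ) (D : Fin (epochEnd k) → Traj S K H) (s : S)
    (a : Fin K) :
    actionGap (f s) a ≤ 2 * actionGap (epochPred O h k D (φ s)) a + slack O E φ f h k D s ∧
      actionGap (epochPred O h k D (φ s)) a ≤ 2 * actionGap (f s) a + slack O E φ f h k D s := by
  have h0 : ∀ (D : Fin (epochEnd 0) → Traj S K H) x a, actionGap (epochPred O h 0 D x) a = 0 :=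
    fun D x a => by simp [epochPred, actionGap]
  induction k generalizing a with
  -- The zero predictor has no gaps and those of `f` lie in `[0, H]`, so slack `H` suffices.
  | zero =>
    have h1 := (hf s (greedy (f s))).2
    have h2 := (hf s a).1
    have h3 := actionGap_nonneg (f s) a
    have h4 : actionGap (f s) a = f s (greedy (f s)) - f s a := rfl
    rw [h0, slack]
    constructor <;> linarith
  | succ k ih =>
    refine actionGap_comparison (K := K) (epochRate_pos hE (k + 1))
      (epochAct_nonneg O E h k _ (φ s)) ?_
      (ih fun j => D (Fin.castLE (epochEnd_le_succ k) j)) a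
    intro b
    set D' : Fin (epochEnd k) → Traj S K H := fun j => D (Fin.castLE (epochEnd_le_succ k) j)
    refine (one_le_mul_invGap (epochRate_nonneg (K := K) E k) (epochPred O h k D' (φ s)) b).trans ?_
    refine mul_le_mul_of_nonneg_right ?_ (epochAct_nonneg O E h k D' (φ s) b)
    -- The exploration guarantee holds for the old rate and is needed for the new one. After epoch
    -- `0` the gaps vanish and the rate is irrelevant; afterwards the rates increase weakly.
    rcases k with _ | k
    · simp [h0]
    · have := mul_le_mul_of_nonneg_right (epochRate_le_succ (K := K) hE hmono k)
        (actionGap_nonneg (epochPred O h (k + 1) D' (φ s)) b)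
      linarith

/-- True gaps are at most twice the predicted ones plus slack, and the predicted gaps cost at most
`K/γ` on average under inverse gap weighting. -/
theorem sum_epochAct_mul_actionGap_le (O : Oracle S X K H) {E : ℕ → ℝ}
    (hE : ∀ n, 1 ≤ n → 0 < E n) (hmono : ∀ m n : ℕ, 1 ≤ m → m ≤ n → E n ≤ E m) (φ : S → X)
    {f : S → Fin K → ℝ} (hf : ∀ s a, f s a ∈ Set.Icc (0 : ℝ) H) (h k : ℕ)
    (D : Fin (epochEnd k) → Traj S K H) (s : S) :
    ∑ a, epochAct O E h k D (φ s) a * actionGap (f s) a ≤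
      (if k = 0 then 0 else 2 * (K / epochRate K E k)) + slack O E φ f h k D s := by
  have h1 : ∑ a, epochAct O E h k D (φ s) a * actionGap (f s) a ≤
      2 * ∑ a, epochAct O E h k D (φ s) a * actionGap (epochPred O h k D (φ s)) a
        + slack O E φ f h k D s := by
    have h2 : ∑ a, epochAct O E h k D (φ s) a * slack O E φ f h k D s = slack O E φ f h k D s := by
      rw [← Finset.sum_mul, sum_epochAct, one_mul]
    rw [← h2, Finset.mul_sum, ← Finset.sum_add_distrib]
    refine Finset.sum_le_sum fun a _ => ?_
    have := mul_le_mul_of_nonneg_left (epochPred_comparison O hE hmono φ hf h k D s a).1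
      (epochAct_nonneg O E h k D (φ s) a)
    linarith
  refine h1.trans (add_le_add ?_ le_rfl)
  split_ifs with hk
  · subst hk
    simp [epochPred, actionGap]
  · exact mul_le_mul_of_nonneg_left (sum_invGap_mul_actionGap_le (epochRate_pos hE k) _) two_pos.le

theorem card_div_epochRate {E : ℕ → ℝ} (hE : ∀ n, 1 ≤ n → 0 < E n) (k : ℕ) :
    K / epochRate K E (k + 1) = 2 * Real.sqrt (K * E (epochLen (k + 1))) := by
  have h1 := hE _ (epochLen_pos k)
  have h2 := card_pos (K := K)
  have h3 := Real.sqrt_pos.2 h1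
  have h4 := Real.sqrt_pos.2 h2
  rw [epochRate, if_neg (by omega), Real.sqrt_div h2.le, Real.sqrt_mul h2.le]
  field_simp
  rw [Real.sq_sqrt h2.le]

theorem epochRate_mul {E : ℕ → ℝ} (hE : ∀ n, 1 ≤ n → 0 < E n) (k : ℕ) :
    epochRate K E (k + 1) * E (epochLen (k + 1)) = Real.sqrt (K * E (epochLen (k + 1))) / 2 := by
  have h1 := hE _ (epochLen_pos k)
  have h2 := card_pos (K := K)
  have h3 := Real.sqrt_pos.2 h1
  rw [epochRate, if_neg (by omega), Real.sqrt_div h2.le, Real.sqrt_mul h2.le]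
  have h4 : E (epochLen (k + 1)) = Real.sqrt (E (epochLen (k + 1))) ^ 2 := (Real.sq_sqrt h1.le).symm
  field_simp
  rw [← h4]

end Epochs

/-! ### Joint measurability of predictors, action distributions and slack in data and state -/

section Measurability

variable {S X : Type*} {K H : ℕ} [MeasurableSpace S] [MeasurableSpace X]

theorem measurable_epochPred {O : Oracle S X K H} (hO : O.IsMeasurable) (h k : ℕ) (a : Fin K) :
    Measurable fun p : (Fin (epochEnd k) → Traj S K H) × X => epochPred O h k p.1 p.2 a := by
  unfold epochPred
  split_ifs with hk
  · exact measurable_const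
  · have hj : ∀ j : Fin (epochLen k), epochEnd (k - 1) + (j : ℕ) < epochEnd k := fun j => by
      have := j.2
      unfold epochLen at this
      omega
    have hr : Measurable fun p : (Fin (epochEnd k) → Traj S K H) × X =>
        ((fun j : Fin (epochLen k) => p.1 ⟨epochEnd (k - 1) + j, hj j⟩), p.2) :=
      (measurable_pi_iff.2 fun j =>
        (measurable_pi_apply (⟨_, hj j⟩ : Fin (epochEnd k))).comp measurable_fst).prodMk
        measurable_snd
    exact (hO (epochLen k) h a).comp hr

variable [NeZero K]

theorem measurable_epochAct {O : Oracle S X K H} (hO : O.IsMeasurable) (E : ℕ → ℝ) (h k : ℕ)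
    (a : Fin K) :
    Measurable fun p : (Fin (epochEnd k) → Traj S K H) × X => epochAct O E h k p.1 p.2 a :=
  (measurable_invGap _ a).comp (measurable_pi_iff.2 fun b => measurable_epochPred hO h k b)

theorem measurable_falcon {O : Oracle S X K H} (hO : O.IsMeasurable) (E : ℕ → ℝ) (h t : ℕ)
    (a : Fin K) : Measurable fun p : (Fin t → Traj S K H) × X => falcon O E h t p.1 p.2 a := by
  have hr : Measurable fun p : (Fin t → Traj S K H) × X =>
      ((fun j => p.1 (Fin.castLE (epochEnd_log_le t) j) :
        Fin (epochEnd (Nat.log 2 t)) → Traj S K H), p.2) :=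
    ((measurable_restrict (epochEnd_log_le t)).comp measurable_fst).prodMk measurable_snd
  have hm := (measurable_epochAct hO E h (Nat.log 2 t) a).comp hr
  simp_rw [falcon_eq_epochAct]
  exact hm

theorem measurable_slack {O : Oracle S X K H} (hO : O.IsMeasurable) (E : ℕ → ℝ) {φ : S → X}
    (hφ : Measurable φ) {f : S → Fin K → ℝ} (hf : ∀ a, Measurable fun s => f s a) (h k : ℕ) :
    Measurable fun p : (Fin (epochEnd k) → Traj S K H) × S => slack O E φ f h k p.1 p.2 := by
  induction k with
  | zero => exact measurable_const
  | succ k ih =>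
    have hr : Measurable fun p : (Fin (epochEnd (k + 1)) → Traj S K H) × S =>
        (fun j => p.1 (Fin.castLE (epochEnd_le_succ k) j) : Fin (epochEnd k) → Traj S K H) :=
      (measurable_restrict (epochEnd_le_succ k)).comp measurable_fst
    have hx : Measurable fun p : (Fin (epochEnd (k + 1)) → Traj S K H) × S => φ p.2 :=
      hφ.comp measurable_snd
    have h1 := ih.comp (hr.prodMk measurable_snd)
    have h2 := fun a => (measurable_epochAct hO E h k a).comp (hr.prodMk hx)
    have h3 := fun a => (measurable_epochPred hO h (k + 1) a).comp (measurable_fst.prodMk hx)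
    have h4 : ∀ a, Measurable fun p : (Fin (epochEnd (k + 1)) → Traj S K H) × S => f p.2 a :=
      fun a => (hf a).comp measurable_snd
    have h5 := Finset.measurable_fun_sum Finset.univ fun a _ =>
      (h2 a).mul (((h3 a).sub (h4 a)).pow_const 2)
    exact ((((h5.const_mul (4 * epochRate K E (k + 1))).const_add
      (K / (4 * epochRate K E (k + 1)))).const_mul (4 / 3)).add (h1.div_const 3))

end Measurability

/-! ### Policies that the algorithm executes -/

theorem replaceStep_self {S : Type*} {K : ℕ} (π : Policy S K) (h : ℕ) (p : S → Fin K → ℝ) :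
    replaceStep π h p h = p := Function.update_self _ _ _

theorem replaceStep_of_ne {S : Type*} {K : ℕ} (π : Policy S K) {h i : ℕ} (hi : i ≠ h)
    (p : S → Fin K → ℝ) :
    replaceStep π h p i = π i := Function.update_of_ne hi _ _

section Policies

variable {S X Ω Ω' : Type*} [MeasurableSpace S] [MeasurableSpace Ω] [MeasurableSpace Ω']
  [MeasurableSpace X] {K : ℕ}

theorem IsPolicyFamily.comp {π : Ω → Policy S K} (hπ : IsPolicyFamily π) {g : Ω' → Ω}
    (hg : Measurable g) : IsPolicyFamily fun ω => π (g ω) :=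
  ⟨fun ω => hπ.isPolicy (g ω), fun h a => (hπ.measurable h a).comp
    ((hg.comp measurable_fst).prodMk measurable_snd)⟩

theorem IsPolicyFamily.replaceStep {π : Ω → Policy S K} (hπ : IsPolicyFamily π) (h : ℕ)
    {p : Ω → S → Fin K → ℝ} (h0 : ∀ ω s a, 0 ≤ p ω s a) (h1 : ∀ ω s, ∑ a, p ω s a = 1)
    (hm : ∀ a, Measurable fun x : Ω × S => p x.1 x.2 a) :
    IsPolicyFamily fun ω => replaceStep (π ω) h (p ω) := by
  refine ⟨fun ω => ⟨fun i s a => ?_, fun i s => ?_, fun i a => ?_⟩, fun i a => ?_⟩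
  all_goals by_cases hi : i = h
  · subst hi; rw [replaceStep_self]; exact h0 ω s a
  · rw [replaceStep_of_ne _ hi]; exact (hπ.isPolicy ω).nonneg i s a
  · subst hi; rw [replaceStep_self]; exact h1 ω s
  · rw [replaceStep_of_ne _ hi]; exact (hπ.isPolicy ω).sum_eq_one i s
  · subst hi; simp only [replaceStep_self]; exact (hm a).comp measurable_prodMk_left
  · simp only [replaceStep_of_ne _ hi]; exact (hπ.isPolicy ω).measurable i a
  · subst hi; simp only [replaceStep_self]; exact hm a
  · simp only [replaceStep_of_ne _ hi]; exact hπ.measurable i a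

omit [MeasurableSpace S] in
theorem IsFeaturePolicy.replaceStep {φ : S → X} {π : Policy S K} (hπ : IsFeaturePolicy φ π)
    (h : ℕ) {p : S → Fin K → ℝ} (hp : ∀ a, DependsOnFeature φ fun s => p s a) :
    IsFeaturePolicy φ (replaceStep π h p) := by
  intro i a
  by_cases hi : i = h
  · subst hi; rw [replaceStep_self]; exact hp a
  · rw [replaceStep_of_ne _ hi]; exact hπ i a

namespace MDP

variable {M : MDP S K}

theorem Q_replaceStep (π : Policy S K) (H h : ℕ) (p : S → Fin K → ℝ) :
    M.Q H (replaceStep π h p) h = M.Q H π h :=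
  funext fun s => funext fun a =>
    Q_congr H h (fun i hi => replaceStep_of_ne π (by omega) p) s a

theorem stateLaw_replaceStep (π : Policy S K) (h : ℕ) (p : S → Fin K → ℝ) :
    M.stateLaw (replaceStep π h p) h = M.stateLaw π h :=
  stateLaw_congr fun i hi => replaceStep_of_ne π (by omega) p

theorem regret_congr [NeZero K] {π π' : Policy S K} (H h : ℕ) (he : ∀ i, h ≤ i → π i = π' i) :
    M.regret H π h = M.regret H π' h := by
  funext s
  have : M.Q H π h s = M.Q H π' h s :=
    funext fun a => Q_congr H h (fun i hi => he i (by omega)) s a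
  rw [regret, regret, this, he h le_rfl]

end MDP

variable {H : ℕ} [NeZero K] {M : MDP S K} {O : Oracle S X K H} {E : ℕ → ℝ} {φ : S → X}

theorem isPolicyFamily_epochAct (hO : O.IsMeasurable) (E : ℕ → ℝ) (hφ : Measurable φ)
    {π : Policy S K} (hπ : IsPolicy π) (h k : ℕ) :
    IsPolicyFamily fun D => replaceStep π h fun s => epochAct O E h k D (φ s) := by
  have hx : Measurable fun p : (Fin (epochEnd k) → Traj S K H) × S => (p.1, φ p.2) :=
    measurable_fst.prodMk (hφ.comp measurable_snd)
  exact IsPolicyFamily.replaceStep (π := fun _ => π) (p := fun D s => epochAct O E h k D (φ s))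
    ⟨fun _ => hπ, fun i a => (hπ.measurable i a).comp measurable_snd⟩ h
    (fun D s a => epochAct_nonneg O E h k D (φ s) a) (fun D s => sum_epochAct O E h k D (φ s))
    fun a => by
      have hm := (measurable_epochAct hO E h k a).comp hx
      exact hm

theorem isFeaturePolicy_epochAct (hO : O.IsMeasurable) (E : ℕ → ℝ)
    {π : Policy S K} (hπφ : IsFeaturePolicy φ π) (h k : ℕ) (D : Fin (epochEnd k) → Traj S K H) :
    IsFeaturePolicy φ (replaceStep π h fun s => epochAct O E h k D (φ s)) :=
  hπφ.replaceStep h fun a =>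
    ⟨_, (measurable_epochAct hO E h k a).comp measurable_prodMk_left, fun _ => rfl⟩

theorem isPolicyFamily_falcon (hO : O.IsMeasurable) (E : ℕ → ℝ) (hφ : Measurable φ)
    {π : Ω → Policy S K} (hπ : IsPolicyFamily π) (h t : ℕ) :
    IsPolicyFamily fun p : Ω × (Fin t → Traj S K H) =>
      replaceStep (π p.1) h fun s => falcon O E h t p.2 (φ s) := by
  have hx : Measurable fun x : (Ω × (Fin t → Traj S K H)) × S => (x.1.2, φ x.2) :=
    (measurable_snd.comp measurable_fst).prodMk (hφ.comp measurable_snd)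
  exact IsPolicyFamily.replaceStep (π := fun p : Ω × (Fin t → Traj S K H) => π p.1)
    (p := fun p s => falcon O E h t p.2 (φ s))
    (hπ.comp measurable_fst) h (fun p s a => falcon_nonneg O E h t p.2 (φ s) a)
    (fun p s => sum_falcon O E h t p.2 (φ s)) fun a => by
      have hm := (measurable_falcon hO E h t a).comp hx
      exact hm

/-- Law of the trajectory of round `t`, given those of the earlier rounds. -/
def roundLaw (M : MDP S K) (O : Oracle S X K H) (E : ℕ → ℝ) (φ : S → X) (π : Policy S K) (h t : ℕ)
    (D : Fin t → Traj S K H) : Measure (Traj S K H) :=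
  M.trajLaw H (replaceStep π h fun s => falcon O E h t D (φ s))

omit [MeasurableSpace X] in
theorem iterLaw_eq_seqLaw (M : MDP S K) (O : Oracle S X K H) (E : ℕ → ℝ) (φ : S → X)
    (π : Policy S K) (h t : ℕ) : iterLaw M O E φ π h t = seqLaw (roundLaw M O E φ π h) t := by
  induction t with
  | zero => rfl
  | succ t ih => rw [iterLaw, seqLaw, ih]; rfl

theorem measurable_roundLaw_family (hO : O.IsMeasurable) (hφ : Measurable φ)
    {π : Ω → Policy S K} (hπ : IsPolicyFamily π) (h t : ℕ) :
    Measurable fun p : Ω × (Fin t → Traj S K H) => roundLaw M O E φ (π p.1) h t p.2 :=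
  MDP.measurable_trajLaw (isPolicyFamily_falcon hO E hφ hπ h t) H

theorem measurable_roundLaw (hO : O.IsMeasurable) (hφ : Measurable φ)
    {π : Policy S K} (hπ : IsPolicy π) (h t : ℕ) : Measurable (roundLaw M O E φ π h t) := by
  have hm := (measurable_roundLaw_family (M := M) (E := E) hO hφ hπ.family h t).comp
    (measurable_prodMk_left (x := ()))
  exact hm

theorem isProbabilityMeasure_roundLaw (hO : O.IsMeasurable) (hφ : Measurable φ)
    {π : Policy S K} (hπ : IsPolicy π) (h t : ℕ) (D : Fin t → Traj S K H) :
    IsProbabilityMeasure (roundLaw M O E φ π h t D) :=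
  MDP.isProbabilityMeasure_trajLaw
    ((isPolicyFamily_falcon hO E hφ hπ.family h t).isPolicy ((), D)) H

theorem isProbabilityMeasure_iterLaw (hO : O.IsMeasurable) (hφ : Measurable φ)
    {π : Policy S K} (hπ : IsPolicy π) (h t : ℕ) :
    IsProbabilityMeasure (iterLaw M O E φ π h t) := by
  rw [iterLaw_eq_seqLaw]
  exact isProbabilityMeasure_seqLaw t (fun s _ => measurable_roundLaw hO hφ hπ h s)
    fun s _ => isProbabilityMeasure_roundLaw hO hφ hπ h s

theorem measurable_iterLaw (hO : O.IsMeasurable) (hφ : Measurable φ)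
    {π : Ω → Policy S K} (hπ : IsPolicyFamily π) (h t : ℕ) :
    Measurable fun ω => iterLaw M O E φ (π ω) h t := by
  simp_rw [iterLaw_eq_seqLaw]
  exact measurable_seqLaw t (fun s _ => measurable_roundLaw_family hO hφ hπ h s)
    fun s _ ω => isProbabilityMeasure_roundLaw hO hφ (hπ.isPolicy ω) h s

/-! ### Expected regret of FALCON+ -/

theorem log_epochEnd_add {k i : ℕ} (hi : i < epochLen (k + 1)) :
    Nat.log 2 (epochEnd k + i) = k := by
  have h := epochEnd_add_epochLen k
  have h2 : epochEnd (k + 1) = 2 ^ (k + 1) := if_neg (by omega)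
  rcases k with _ | k
  -- The first epoch consists of rounds `0` and `1`; round `0` belongs to it through the convention
  -- `Nat.log 2 0 = 0`.
  · have h3 : epochEnd 0 = 0 := if_pos rfl
    exact Nat.log_of_lt (by omega)
  · have h3 : epochEnd (k + 1) = 2 ^ (k + 1) := if_neg (by omega)
    exact Nat.log_eq_of_pow_le_of_lt_pow (by omega) (by omega)

omit [MeasurableSpace S] [MeasurableSpace X] in
theorem falcon_of_log_eq {t k : ℕ} (hk : Nat.log 2 t = k) (hle : epochEnd k ≤ t) (h : ℕ)
    (D : Fin t → Traj S K H) (x : X) :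
    falcon O E h t D x = epochAct O E h k (fun j => D (Fin.castLE hle j)) x := by
  subst hk
  exact falcon_eq_epochAct O E h t D x

/-- `epochEnd k + epochLen (k + 1)` equals `epochEnd (k + 1)` only propositionally; a free `t`
avoids casts between the index types. -/
theorem lintegral_seqLaw_block_of_eq {Z : Type*} [MeasurableSpace Z]
    {q : (t : ℕ) → (Fin t → Z) → Measure Z} {s n t : ℕ} (hst : s + n = t) (hs : s ≤ t)
    {p : (Fin s → Z) → Measure Z} (hpm : Measurable p)
    (hpp : ∀ D, IsProbabilityMeasure (p D))
    (hq : ∀ i < n, ∀ D, q (s + i) D = p fun j => D (Fin.castLE (Nat.le_add_right s i) j))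
    {G : (Fin s → Z) → (Fin n → Z) → ℝ≥0∞}
    (hG : Measurable fun x : (Fin s → Z) × (Fin n → Z) => G x.1 x.2)
    (hj : ∀ j : Fin n, s + (j : ℕ) < t) :
    ∫⁻ D, G (fun j => D (Fin.castLE hs j)) (fun j => D ⟨s + j, hj j⟩) ∂seqLaw q t
      = ∫⁻ D, ∫⁻ D', G D D' ∂(Measure.pi fun _ => p D) ∂seqLaw q s := by
  subst hst
  exact lintegral_seqLaw_block hpm hpp hq hG

omit [NeZero K] in
/-- Mean squared error of a predictor at step `h`, for actions drawn according to `p`. -/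
theorem lintegral_predictor_error_le (hO : O.IsMeasurable) (hErr : O.HasError M φ E)
    {π : Policy S K} (hφ : Measurable φ) {h : ℕ} (hh : h < H)
    {p : S → Fin K → ℝ} (hp : IsPolicy (replaceStep π h p))
    (hpφ : IsFeaturePolicy φ (replaceStep π h p)) {n : ℕ} (hn : 1 ≤ n) :
    ∫⁻ D, ∫⁻ s, ENNReal.ofReal (∑ a, p s a * (O n D h (φ s) a - M.Q H π h s a) ^ 2)
        ∂M.stateLaw π h ∂(Measure.pi fun _ : Fin n => M.trajLaw H (replaceStep π h p))
      ≤ ENNReal.ofReal (E n) := by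
  refine le_trans (le_of_eq (lintegral_congr fun D => ?_)) (hErr _ hp hpφ n hn ⟨h, hh⟩)
  have hm : Measurable fun x : S × Fin K =>
      ENNReal.ofReal ((O n D h (φ x.1) x.2 - M.Q H (replaceStep π h p) h x.1 x.2) ^ 2) :=
    measurable_from_prod_countable_left fun a =>
      ((((hO n h a).comp measurable_prodMk_left).comp hφ).sub
        (MDP.measurable_Q hp H h a)).pow_const 2 |>.ennreal_ofReal
  refine Eq.trans ?_ (MDP.lintegral_trajLaw_coord hp (F := fun s a =>
    ENNReal.ofReal ((O n D h (φ s) a - M.Q H (replaceStep π h p) h s a) ^ 2)) hm ⟨h, hh⟩).symm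
  simp only [MDP.stateLaw_replaceStep, MDP.Q_replaceStep, replaceStep_self]
  refine lintegral_congr fun s => ?_
  have h0 : ∀ a, 0 ≤ p s a := fun a => by
    have := hp.nonneg h s a
    rwa [replaceStep_self] at this
  rw [ENNReal.ofReal_sum_of_nonneg fun a _ => mul_nonneg (h0 a) (sq_nonneg _)]
  exact Finset.sum_congr rfl fun a _ => ENNReal.ofReal_mul (h0 a)

/-- Bound on the expected slack of the predictor that is fitted to epoch `k`. -/
def slackBound (K H : ℕ) (E : ℕ → ℝ) : ℕ → ℝ
  | 0 => H
  | k + 1 => 10 / 3 * Real.sqrt (K * E (epochLen (k + 1))) + slackBound K H E k / 3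

theorem slackBound_nonneg (K H : ℕ) (E : ℕ → ℝ) (k : ℕ) : 0 ≤ slackBound K H E k := by
  induction k with
  | zero => exact Nat.cast_nonneg H
  | succ k ih => rw [slackBound]; positivity

/-- Given the first `epochEnd k` trajectories, the next epoch consists of independent trajectories
of one feature policy, so the oracle bound holds conditionally. Replacing step `h` changes neither
`Q_h` nor the law of `s_h`, so the target and the test state are those of `π`. The previous slack is
handled by marginalization and induction. -/
theorem lintegral_slack_le (hO : O.IsMeasurable) (hErr : O.HasError M φ E)
    (hE : ∀ n, 1 ≤ n → 0 < E n) (hφ : Measurable φ)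
    {π : Policy S K} (hπ : IsPolicy π) (hπφ : IsFeaturePolicy φ π) {h : ℕ} (hh : h < H) (k : ℕ) :
    ∫⁻ D, ∫⁻ s, ENNReal.ofReal (slack O E φ (M.Q H π h) h k D s) ∂M.stateLaw π h
        ∂seqLaw (roundLaw M O E φ π h) (epochEnd k)
      ≤ ENNReal.ofReal (slackBound K H E k) := by
  have hν := MDP.isProbabilityMeasure_stateLaw (M := M) hπ h
  have hqm := measurable_roundLaw (M := M) (E := E) hO hφ hπ h
  have hqp := isProbabilityMeasure_roundLaw (M := M) (E := E) hO hφ hπ h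
  have hμ : ∀ t, IsProbabilityMeasure (seqLaw (roundLaw M O E φ π h) t) := fun t =>
    isProbabilityMeasure_seqLaw t (fun s _ => hqm s) fun s _ => hqp s
  have hQm := MDP.measurable_Q (M := M) hπ H h
  induction k with
  | zero =>
    have := hμ (epochEnd 0)
    simp [slack, slackBound]
  | succ k ih =>
    have := hμ (epochEnd (k + 1))
    have := hμ (epochEnd k)
    set γ := epochRate K E (k + 1) with hγ
    have hγ0 : 0 < γ := epochRate_pos hE (k + 1)
    set n := epochLen (k + 1) with hn
    have hle := epochEnd_le_succ k
    have hj : ∀ j : Fin n, epochEnd k + (j : ℕ) < epochEnd (k + 1) := fun j => by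
      have := epochEnd_add_epochLen k
      have := j.2
      omega
    set g : (Fin (epochEnd k) → Traj S K H) → (Fin n → Traj S K H) → S → ℝ := fun D D' s =>
      ∑ a, epochAct O E h k D (φ s) a * (O n D' h (φ s) a - M.Q H π h s a) ^ 2 with hg
    have hgm : Measurable fun x : ((Fin (epochEnd k) → Traj S K H) × (Fin n → Traj S K H)) × S =>
        ENNReal.ofReal (g x.1.1 x.1.2 x.2) := by
      refine (Finset.measurable_fun_sum _ fun a _ => ?_).ennreal_ofReal
      have hx : Measurable fun x : ((Fin (epochEnd k) → Traj S K H) × (Fin n → Traj S K H)) × S =>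
        φ x.2 := hφ.comp measurable_snd
      have h1 := (measurable_epochAct hO E h k a).comp
        ((measurable_fst.comp measurable_fst).prodMk hx)
      have h2 := (hO n h a).comp ((measurable_snd.comp measurable_fst).prodMk hx)
      have h3 : Measurable fun x : ((Fin (epochEnd k) → Traj S K H) × (Fin n → Traj S K H)) × S =>
        M.Q H π h x.2 a := (hQm a).comp measurable_snd
      exact h1.mul ((h2.sub h3).pow_const 2)
    have hsm := (measurable_slack hO E hφ hQm h k).ennreal_ofReal
    -- Multiplying out the recursion separates a constant, the fresh squared error and the old
    -- slack.
    have hpt : ∀ D s, ENNReal.ofReal (slack O E φ (M.Q H π h) h (k + 1) D s)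
        = ENNReal.ofReal (K / (3 * γ)) + ENNReal.ofReal (16 / 3 * γ) *
            ENNReal.ofReal (g (fun j => D (Fin.castLE hle j))
              (fun j => D ⟨epochEnd k + j, hj j⟩) s)
          + ENNReal.ofReal (1 / 3) * ENNReal.ofReal (slack O E φ (M.Q H π h) h k
            (fun j => D (Fin.castLE hle j)) s) := fun D s => by
      have h1 : 0 ≤ g (fun j => D (Fin.castLE hle j)) (fun j => D ⟨epochEnd k + j, hj j⟩) s :=
        Finset.sum_nonneg fun a _ => mul_nonneg (epochAct_nonneg _ _ _ _ _ _ _) (sq_nonneg _)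
      have h2 := slack_nonneg O E φ (M.Q H π h) h k (fun j => D (Fin.castLE hle j)) s
      rw [← ENNReal.ofReal_mul (by positivity), ← ENNReal.ofReal_mul (by positivity),
        ← ENNReal.ofReal_add (by positivity) (by positivity),
        ← ENNReal.ofReal_add (by positivity) (by positivity)]
      congr 1
      have h3 : slack O E φ (M.Q H π h) h (k + 1) D s
        = 4 / 3 * (K / (4 * γ) + 4 * γ * g (fun j => D (Fin.castLE hle j))
          (fun j => D ⟨epochEnd k + j, hj j⟩) s)
          + slack O E φ (M.Q H π h) h k (fun j => D (Fin.castLE hle j)) s / 3 := rfl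
      rw [h3]
      field_simp
      ring
    have hg1 : Measurable fun x : (Fin (epochEnd k) → Traj S K H) × (Fin n → Traj S K H) =>
        ∫⁻ s, ENNReal.ofReal (g x.1 x.2 s) ∂M.stateLaw π h := hgm.lintegral_prod_right'
    have hs1 : Measurable fun D : Fin (epochEnd k) → Traj S K H =>
        ∫⁻ s, ENNReal.ofReal (slack O E φ (M.Q H π h) h k D s) ∂M.stateLaw π h :=
      hsm.lintegral_prod_right'
    have hinner : ∀ D, ∫⁻ s, ENNReal.ofReal (slack O E φ (M.Q H π h) h (k + 1) D s)
          ∂M.stateLaw π h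
        = ENNReal.ofReal (K / (3 * γ)) + ENNReal.ofReal (16 / 3 * γ) *
            ∫⁻ s, ENNReal.ofReal (g (fun j => D (Fin.castLE hle j))
              (fun j => D ⟨epochEnd k + j, hj j⟩) s) ∂M.stateLaw π h
          + ENNReal.ofReal (1 / 3) * ∫⁻ s, ENNReal.ofReal (slack O E φ (M.Q H π h) h k
            (fun j => D (Fin.castLE hle j)) s) ∂M.stateLaw π h := fun D => by
      have hgD : Measurable fun s => ENNReal.ofReal (g (fun j => D (Fin.castLE hle j))
          (fun j => D ⟨epochEnd k + j, hj j⟩) s) := by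
        have hm := hgm.comp (measurable_prodMk_left
          (x := ((fun j => D (Fin.castLE hle j)), (fun j : Fin n => D ⟨epochEnd k + j, hj j⟩))))
        exact hm
      have hsD : Measurable fun s => ENNReal.ofReal (slack O E φ (M.Q H π h) h k
          (fun j => D (Fin.castLE hle j)) s) := by
        have hm := hsm.comp (measurable_prodMk_left (x := (fun j => D (Fin.castLE hle j))))
        exact hm
      simp_rw [hpt]
      rw [lintegral_add_left ((hgD.const_mul _).const_add _), lintegral_add_left measurable_const,
        lintegral_const_mul _ hgD, lintegral_const_mul _ hsD]
      simp
    have hr1 := measurable_restrict (Z := Traj S K H) hle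
    have hr2 : Measurable fun (D : Fin (epochEnd (k + 1)) → Traj S K H) (j : Fin n) =>
        D ⟨epochEnd k + j, hj j⟩ :=
      measurable_pi_iff.2 fun j => measurable_pi_apply (⟨_, hj j⟩ : Fin (epochEnd (k + 1)))
    have hgD : Measurable fun D : Fin (epochEnd (k + 1)) → Traj S K H =>
        ∫⁻ s, ENNReal.ofReal (g (fun j => D (Fin.castLE hle j))
          (fun j => D ⟨epochEnd k + j, hj j⟩) s) ∂M.stateLaw π h := by
      have hm := hg1.comp (hr1.prodMk hr2)
      exact hm
    have hsD : Measurable fun D : Fin (epochEnd (k + 1)) → Traj S K H =>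
        ∫⁻ s, ENNReal.ofReal (slack O E φ (M.Q H π h) h k (fun j => D (Fin.castLE hle j)) s)
          ∂M.stateLaw π h := by
      have hm := hs1.comp hr1
      exact hm
    simp_rw [hinner]
    rw [lintegral_add_left ((hgD.const_mul _).const_add _), lintegral_add_left measurable_const,
      lintegral_const_mul _ hgD, lintegral_const_mul _ hsD, lintegral_const, measure_univ, mul_one]
    have hfam := isPolicyFamily_epochAct hO E hφ hπ h k
    have hpart1 : ∫⁻ D, ∫⁻ s, ENNReal.ofReal (g (fun j => D (Fin.castLE hle j))
        (fun j => D ⟨epochEnd k + j, hj j⟩) s) ∂M.stateLaw π h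
          ∂seqLaw (roundLaw M O E φ π h) (epochEnd (k + 1)) ≤ ENNReal.ofReal (E n) := by
      rw [lintegral_seqLaw_block_of_eq (epochEnd_add_epochLen k) hle
        (p := fun D => M.trajLaw H (replaceStep π h fun s => epochAct O E h k D (φ s)))
        (MDP.measurable_trajLaw hfam H)
        (fun D => MDP.isProbabilityMeasure_trajLaw (hfam.isPolicy D) H)
        (fun i hi D => by
          rw [roundLaw]
          simp_rw [falcon_of_log_eq (log_epochEnd_add hi) (Nat.le_add_right _ _)])
        (G := fun D D' => ∫⁻ s, ENNReal.ofReal (g D D' s) ∂M.stateLaw π h) hg1 hj]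
      refine (lintegral_mono fun D => lintegral_predictor_error_le hO hErr hφ hh
        (hfam.isPolicy D) (isFeaturePolicy_epochAct hO E hπφ h k D) (epochLen_pos k)).trans ?_
      simp [hn]
    have hpart2 : ∫⁻ D, ∫⁻ s, ENNReal.ofReal (slack O E φ (M.Q H π h) h k
        (fun j => D (Fin.castLE hle j)) s) ∂M.stateLaw π h
          ∂seqLaw (roundLaw M O E φ π h) (epochEnd (k + 1))
        ≤ ENNReal.ofReal (slackBound K H E k) := by
      rw [lintegral_seqLaw_restrict (F := fun D => ∫⁻ s, ENNReal.ofReal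
        (slack O E φ (M.Q H π h) h k D s) ∂M.stateLaw π h) hle (fun r _ => hqm r)
        (fun r _ => hqp r) hs1]
      exact ih
    refine (add_le_add (add_le_add le_rfl (mul_le_mul_right hpart1 _))
      (mul_le_mul_right hpart2 _)).trans ?_
    have hEn := hE n (epochLen_pos k)
    have hsb := slackBound_nonneg K H E k
    rw [← ENNReal.ofReal_mul (by positivity), ← ENNReal.ofReal_mul (by positivity),
      ← ENNReal.ofReal_add (by positivity) (by positivity),
      ← ENNReal.ofReal_add (by positivity) (by positivity)]
    refine ENNReal.ofReal_le_ofReal (le_of_eq ?_)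
    -- The chosen rate gives `K/γ = 2√(K E(n))` and `γ E(n) = √(K E(n))/2`; the two contributions
    -- `2/3` and `8/3` add up to the `10/3` in `slackBound`.
    have e1 := card_div_epochRate (K := K) hE k
    have e2 := epochRate_mul (K := K) hE k
    rw [← hγ, ← hn] at e1 e2
    have e3 : K / (3 * γ) = (K / γ) / 3 := by field_simp
    rw [slackBound, e3, e1, ← hn, mul_assoc (16 / 3) γ, e2]
    ring

/-- Bound on the expected regret of the distribution that is used after epoch `k`. -/
def roundBound (K H : ℕ) (E : ℕ → ℝ) (k : ℕ) : ℝ :=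
  (if k = 0 then 0 else 4 * Real.sqrt (K * E (epochLen k))) + slackBound K H E k

theorem lintegral_falcon_regret_le (hO : O.IsMeasurable) (hErr : O.HasError M φ E)
    (hE : ∀ n, 1 ≤ n → 0 < E n) (hmono : ∀ m n : ℕ, 1 ≤ m → m ≤ n → E n ≤ E m) (hφ : Measurable φ)
    {π : Policy S K} (hπ : IsPolicy π) (hπφ : IsFeaturePolicy φ π) {h : ℕ} (hh : h < H) (t : ℕ) :
    ∫⁻ D, ∫⁻ s, ENNReal.ofReal (∑ a, falcon O E h t D (φ s) a * actionGap (M.Q H π h s) a)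
        ∂M.stateLaw π h ∂seqLaw (roundLaw M O E φ π h) t
      ≤ ENNReal.ofReal (roundBound K H E (Nat.log 2 t)) := by
  have hν := MDP.isProbabilityMeasure_stateLaw (M := M) hπ h
  have hqm := measurable_roundLaw (M := M) (E := E) hO hφ hπ h
  have hqp := isProbabilityMeasure_roundLaw (M := M) (E := E) hO hφ hπ h
  set k := Nat.log 2 t with hk
  have hμ := isProbabilityMeasure_seqLaw (epochEnd k) (fun s _ => hqm s) fun s _ => hqp s
  have hsm := (measurable_slack hO E hφ (MDP.measurable_Q (M := M) hπ H h) h k).ennreal_ofReal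
  have hs1 : Measurable fun D : Fin (epochEnd k) → Traj S K H =>
      ∫⁻ s, ENNReal.ofReal (slack O E φ (M.Q H π h) h k D s) ∂M.stateLaw π h :=
    hsm.lintegral_prod_right'
  set b : ℝ := if k = 0 then 0 else 4 * Real.sqrt (K * E (epochLen k)) with hb
  have hb0 : 0 ≤ b := by rw [hb]; split_ifs <;> positivity
  have hb' : (if k = 0 then 0 else 2 * (K / epochRate K E k)) = b := by
    rw [hb]
    split_ifs with h0
    · rfl
    · obtain ⟨j, hj⟩ := Nat.exists_eq_succ_of_ne_zero h0
      rw [hj, card_div_epochRate hE j]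
      ring
  calc _ ≤ ∫⁻ D, ∫⁻ s, (ENNReal.ofReal b + ENNReal.ofReal (slack O E φ (M.Q H π h) h k
            (fun j => D (Fin.castLE (epochEnd_log_le t) j)) s))
          ∂M.stateLaw π h ∂seqLaw (roundLaw M O E φ π h) t := by
        refine lintegral_mono fun D => lintegral_mono fun s => ?_
        rw [← ENNReal.ofReal_add hb0 (slack_nonneg _ _ _ _ _ _ _ _), ← hb']
        refine ENNReal.ofReal_le_ofReal ?_
        simp_rw [falcon_eq_epochAct]
        exact sum_epochAct_mul_actionGap_le O hE hmono φ (fun s a => MDP.Q_mem hπ hh s a) h k _ s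
    _ = ∫⁻ D, ∫⁻ s, (ENNReal.ofReal b + ENNReal.ofReal (slack O E φ (M.Q H π h) h k D s))
          ∂M.stateLaw π h ∂seqLaw (roundLaw M O E φ π h) (epochEnd k) :=
        lintegral_seqLaw_restrict (F := fun D => ∫⁻ s, (ENNReal.ofReal b + ENNReal.ofReal
          (slack O E φ (M.Q H π h) h k D s)) ∂M.stateLaw π h) (epochEnd_log_le t)
          (fun r _ => hqm r) (fun r _ => hqp r) (hsm.const_add _).lintegral_prod_right'
    _ = ENNReal.ofReal b + ∫⁻ D, ∫⁻ s, ENNReal.ofReal (slack O E φ (M.Q H π h) h k D s)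
          ∂M.stateLaw π h ∂seqLaw (roundLaw M O E φ π h) (epochEnd k) := by
        simp_rw [lintegral_add_left measurable_const, lintegral_const, measure_univ, mul_one]
    _ ≤ ENNReal.ofReal b + ENNReal.ofReal (slackBound K H E k) :=
        add_le_add le_rfl (lintegral_slack_le hO hErr hE hφ hπ hπφ hh k)
    _ = _ := by rw [← ENNReal.ofReal_add hb0 (slackBound_nonneg K H E k)]; rfl

end Policies

/-! ### Summing the bounds over the rounds -/

section Bounds

variable {K H N : ℕ} {E : ℕ → ℝ} {W : ℝ}

theorem sqrt_epochLen_le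
    (hw : ∀ m : ℕ, 1 ≤ m → m ≤ N → m * Real.sqrt (K * E m) ≤ W) {k : ℕ}
    (hk : epochEnd (k + 1) ≤ N) : Real.sqrt (K * E (epochLen (k + 1))) ≤ W / 2 ^ k := by
  have h1 := hw _ (epochLen_pos k) ((epochLen_le _).trans hk)
  have h2 : (2 : ℝ) ^ k ≤ epochLen (k + 1) := by exact_mod_cast two_pow_le_epochLen k
  rw [le_div_iff₀ (by positivity), mul_comm]
  exact (mul_le_mul_of_nonneg_right h2 (Real.sqrt_nonneg _)).trans h1

/-- The slack contracts by `1/3` per epoch, faster than the halving of `W / 2^k`, so no logarithm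
arises here. The constant `20` solves `10/3 + c/3 = c/2`; the initial slack `H` is covered by `H ≤
W`. -/
theorem slackBound_le (hW : (H : ℝ) ≤ W)
    (hw : ∀ m : ℕ, 1 ≤ m → m ≤ N → m * Real.sqrt (K * E m) ≤ W) {k : ℕ}
    (hk : epochEnd k ≤ N) : slackBound K H E k ≤ 20 * (W / 2 ^ k) := by
  have hW0 : 0 ≤ W := (Nat.cast_nonneg H).trans hW
  induction k with
  | zero => rw [slackBound, pow_zero, div_one]; linarith
  | succ k ih =>
    have h1 := sqrt_epochLen_le hw hk
    have h2 := ih ((epochEnd_le_succ k).trans hk)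
    have h3 : W / 2 ^ (k + 1) = W / 2 ^ k / 2 := by rw [pow_succ]; field_simp
    rw [slackBound, h3]
    have h4 : 0 ≤ W / 2 ^ k := by positivity
    linarith

/-- The exploitation cost adds `8` to the slack constant `20`, and `t + 1 ≤ 2 · 2^(log₂ t)` doubles
`28` to `56`. -/
theorem roundBound_le (hW : (H : ℝ) ≤ W)
    (hw : ∀ m : ℕ, 1 ≤ m → m ≤ N → m * Real.sqrt (K * E m) ≤ W) {t : ℕ} (ht : t < N) :
    roundBound K H E (Nat.log 2 t) ≤ 56 * W * ((t : ℝ) + 1)⁻¹ := by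
  have hW0 : 0 ≤ W := (Nat.cast_nonneg H).trans hW
  have hk : epochEnd (Nat.log 2 t) ≤ N := (epochEnd_log_le t).trans ht.le
  have h1 : roundBound K H E (Nat.log 2 t) ≤ 28 * (W / 2 ^ Nat.log 2 t) := by
    have h2 := slackBound_le hW hw hk
    have h3 : 0 ≤ W / 2 ^ Nat.log 2 t := by positivity
    rw [roundBound]
    split_ifs with h0
    · linarith
    · obtain ⟨j, hj⟩ := Nat.exists_eq_succ_of_ne_zero h0
      rw [hj] at h2 h3 hk ⊢
      have h4 := sqrt_epochLen_le hw hk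
      have h5 : W / 2 ^ (j + 1) = W / 2 ^ j / 2 := by rw [pow_succ]; field_simp
      rw [Nat.succ_eq_add_one] at *
      rw [h5] at h2 h3 ⊢
      linarith
  refine h1.trans ?_
  have h2 : ((t : ℝ) + 1) ≤ 2 * 2 ^ Nat.log 2 t := by
    have : t + 1 ≤ 2 ^ (Nat.log 2 t + 1) := Nat.lt_pow_succ_log_self (by norm_num) t
    rw [pow_succ, mul_comm] at this
    exact_mod_cast this
  have h3 : (0 : ℝ) < t + 1 := by positivity
  rw [← div_eq_mul_inv, mul_div_assoc', div_le_div_iff₀ (by positivity) h3]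
  nlinarith [mul_le_mul_of_nonneg_left h2 hW0]

theorem sum_inv_le_one_add_log (N : ℕ) :
    ∑ t : Fin N, ((t : ℝ) + 1)⁻¹ ≤ 1 + Real.log N := by
  have h := harmonic_le_one_add_log N
  rw [harmonic] at h
  rw [Fin.sum_univ_eq_sum_range fun t : ℕ => ((t : ℝ) + 1)⁻¹]
  push_cast at h
  exact h

end Bounds

/-! ### One iteration of the jump-start algorithm -/

section Iteration

variable {S X Ω : Type*} [MeasurableSpace S] [MeasurableSpace X] [MeasurableSpace Ω] {K H : ℕ}
  [NeZero K] {M : MDP S K} {O : Oracle S X K H} {E : ℕ → ℝ} {φ : S → X} {N : ℕ}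

omit [MeasurableSpace S] [MeasurableSpace X] in
theorem mixture_nonneg (O : Oracle S X K H) (E : ℕ → ℝ) (φ : S → X) (h : ℕ)
    (D : Fin N → Traj S K H) (s : S) (a : Fin K) : 0 ≤ mixture O E φ h D s a :=
  mul_nonneg (by positivity) (Finset.sum_nonneg fun t _ => falcon_nonneg O E h t _ (φ s) a)

omit [MeasurableSpace S] [MeasurableSpace X] in
theorem sum_mixture (hN : 1 ≤ N) (O : Oracle S X K H) (E : ℕ → ℝ) (φ : S → X) (h : ℕ)
    (D : Fin N → Traj S K H) (s : S) : ∑ a, mixture O E φ h D s a = 1 := by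
  have hN' : (N : ℝ) ≠ 0 := by positivity
  simp only [mixture]
  rw [← Finset.mul_sum, Finset.sum_comm]
  simp_rw [sum_falcon]
  simp [hN']

theorem measurable_mixture_feature (hO : O.IsMeasurable) (E : ℕ → ℝ) (h : ℕ) (a : Fin K) :
    Measurable fun p : (Fin N → Traj S K H) × X =>
      (1 / (N : ℝ)) * ∑ t : Fin N, falcon O E h t (fun j => p.1 (Fin.castLE t.2.le j)) p.2 a := by
  refine (Finset.measurable_fun_sum _ fun t _ => ?_).const_mul _
  have hr : Measurable fun p : (Fin N → Traj S K H) × X =>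
      ((fun j => p.1 (Fin.castLE t.2.le j) : Fin t → Traj S K H), p.2) :=
    ((measurable_restrict t.2.le).comp measurable_fst).prodMk measurable_snd
  have hm := (measurable_falcon hO E h t a).comp hr
  exact hm

theorem IsPolicyFamily.replaceStep_mixture (hN : 1 ≤ N) (hO : O.IsMeasurable) (E : ℕ → ℝ)
    (hφ : Measurable φ) {π : Ω → Policy S K} (hπ : IsPolicyFamily π) (h : ℕ)
    {g : Ω → Fin N → Traj S K H} (hg : Measurable g) :
    IsPolicyFamily fun ω => JSRL.replaceStep (π ω) h (mixture O E φ h (g ω)) := by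
  refine hπ.replaceStep h (fun ω => mixture_nonneg O E φ h (g ω))
    (fun ω => sum_mixture hN O E φ h (g ω)) fun a => ?_
  have hx : Measurable fun x : Ω × S => (g x.1, φ x.2) :=
    (hg.comp measurable_fst).prodMk (hφ.comp measurable_snd)
  have hm := (measurable_mixture_feature (N := N) hO E h a).comp hx
  exact hm

theorem IsFeaturePolicy.replaceStep_mixture (hO : O.IsMeasurable) (E : ℕ → ℝ)
    {π : Policy S K} (hπφ : IsFeaturePolicy φ π) (h : ℕ) (D : Fin N → Traj S K H) :
    IsFeaturePolicy φ (JSRL.replaceStep π h (mixture O E φ h D)) :=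
  hπφ.replaceStep h fun a => ⟨_, (measurable_mixture_feature hO E h a).comp measurable_prodMk_left,
    fun _ => rfl⟩

omit [MeasurableSpace X] in
-- Regret at step `h` is linear in the distribution at that step, and `Q_h` does not see this
-- distribution; so the passage from online regret to the mixture is exact.
theorem regret_replaceStep_mixture (M : MDP S K) (O : Oracle S X K H) (E : ℕ → ℝ) (φ : S → X)
    (π : Policy S K) (h : ℕ) (D : Fin N → Traj S K H) (s : S) :
    M.regret H (replaceStep π h (mixture O E φ h D)) h s = ∑ t : Fin N, 1 / (N : ℝ) *
      ∑ a, falcon O E h t (fun j => D (Fin.castLE t.2.le j)) (φ s) a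
        * actionGap (M.Q H π h s) a := by
  rw [MDP.regret, MDP.Q_replaceStep, replaceStep_self]
  simp only [mixture, Finset.mul_sum, Finset.sum_mul]
  rw [Finset.sum_comm]
  exact Finset.sum_congr rfl fun t _ => Finset.sum_congr rfl fun a _ => mul_assoc _ _ _

theorem lintegral_mixture_regret_le (hO : O.IsMeasurable) (hErr : O.HasError M φ E)
    (hE : ∀ n, 1 ≤ n → 0 < E n) (hmono : ∀ m n : ℕ, 1 ≤ m → m ≤ n → E n ≤ E m) (hφ : Measurable φ)
    {π : Policy S K} (hπ : IsPolicy π) (hπφ : IsFeaturePolicy φ π) {h : ℕ} (hh : h < H) {W : ℝ}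
    (hW : (H : ℝ) ≤ W) (hw : ∀ m : ℕ, 1 ≤ m → m ≤ N → m * Real.sqrt (K * E m) ≤ W) :
    ∫⁻ D, ∫⁻ s, ENNReal.ofReal (M.regret H (replaceStep π h (mixture O E φ h D)) h s)
        ∂M.stateLaw π h ∂iterLaw M O E φ π h N
      ≤ ENNReal.ofReal (1 / N * (56 * W * (1 + Real.log N))) := by
  have hν := MDP.isProbabilityMeasure_stateLaw (M := M) hπ h
  have hW0 : 0 ≤ W := (Nat.cast_nonneg H).trans hW
  have hqm := measurable_roundLaw (M := M) (E := E) hO hφ hπ h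
  have hqp := isProbabilityMeasure_roundLaw (M := M) (E := E) hO hφ hπ h
  set F : (t : ℕ) → (Fin t → Traj S K H) → S → ℝ := fun t D s =>
    ∑ a, falcon O E h t D (φ s) a * actionGap (M.Q H π h s) a with hF
  have hF0 : ∀ t D s, 0 ≤ F t D s := fun t D s => Finset.sum_nonneg fun a _ =>
    mul_nonneg (falcon_nonneg O E h t D (φ s) a) (actionGap_nonneg _ a)
  have hFm : ∀ t, Measurable fun p : (Fin t → Traj S K H) × S => ENNReal.ofReal (F t p.1 p.2) := by
    refine fun t => (Finset.measurable_fun_sum _ fun a _ => ?_).ennreal_ofReal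
    have hx : Measurable fun p : (Fin t → Traj S K H) × S => (p.1, φ p.2) :=
      measurable_fst.prodMk (hφ.comp measurable_snd)
    have h1 := (measurable_falcon hO E h t a).comp hx
    have h2 : Measurable fun p : (Fin t → Traj S K H) × S => M.Q H π h p.2 :=
      measurable_pi_iff.2 fun b => (MDP.measurable_Q hπ H h b).comp measurable_snd
    exact h1.mul ((measurable_actionGap a).comp h2)
  have hI : ∀ t, Measurable fun D : Fin t → Traj S K H =>
      ∫⁻ s, ENNReal.ofReal (F t D s) ∂M.stateLaw π h := fun t => (hFm t).lintegral_prod_right'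
  have hpt : ∀ D s, ENNReal.ofReal (M.regret H (replaceStep π h (mixture O E φ h D)) h s)
      = ∑ t : Fin N, ENNReal.ofReal (1 / N) *
        ENNReal.ofReal (F t (fun j => D (Fin.castLE t.2.le j)) s) := fun D s => by
    rw [regret_replaceStep_mixture, ENNReal.ofReal_sum_of_nonneg fun t _ =>
      mul_nonneg (by positivity) (hF0 _ _ _)]
    exact Finset.sum_congr rfl fun t _ => ENNReal.ofReal_mul (by positivity)
  have hFD : ∀ (t : Fin N) (D : Fin N → Traj S K H), Measurable fun s =>
      ENNReal.ofReal (F t (fun j => D (Fin.castLE t.2.le j)) s) := fun t D => by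
    have hm := (hFm t).comp
      (measurable_prodMk_left (x := (fun j => D (Fin.castLE t.2.le j) : Fin t → Traj S K H)))
    exact hm
  have hID : ∀ t : Fin N, Measurable fun D : Fin N → Traj S K H =>
      ∫⁻ s, ENNReal.ofReal (F t (fun j => D (Fin.castLE t.2.le j)) s) ∂M.stateLaw π h := fun t => by
    have hm := (hI t).comp (measurable_restrict (Z := Traj S K H) t.2.le)
    exact hm
  have hinner : ∀ D : Fin N → Traj S K H,
      ∫⁻ s, ENNReal.ofReal (M.regret H (replaceStep π h (mixture O E φ h D)) h s) ∂M.stateLaw π h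
      = ∑ t : Fin N, ENNReal.ofReal (1 / N) *
        ∫⁻ s, ENNReal.ofReal (F t (fun j => D (Fin.castLE t.2.le j)) s) ∂M.stateLaw π h :=
    fun D => by
      simp_rw [hpt]
      rw [lintegral_finsetSum _ fun t _ => (hFD t D).const_mul _]
      exact Finset.sum_congr rfl fun t _ => lintegral_const_mul _ (hFD t D)
  simp_rw [hinner, iterLaw_eq_seqLaw]
  rw [lintegral_finsetSum _ fun t _ => (hID t).const_mul _]
  have hround : ∀ t : Fin N, ∫⁻ D, ENNReal.ofReal (1 / N) *
      ∫⁻ s, ENNReal.ofReal (F t (fun j => D (Fin.castLE t.2.le j)) s) ∂M.stateLaw π h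
        ∂seqLaw (roundLaw M O E φ π h) N
      ≤ ENNReal.ofReal (1 / N * (56 * W * ((t : ℝ) + 1)⁻¹)) := fun t => by
    rw [lintegral_const_mul _ (hID t), ENNReal.ofReal_mul (by positivity),
      lintegral_seqLaw_restrict (F := fun D => ∫⁻ s, ENNReal.ofReal (F t D s) ∂M.stateLaw π h)
        t.2.le (fun r _ => hqm r) (fun r _ => hqp r) (hI t)]
    refine mul_le_mul_right ?_ _
    exact (lintegral_falcon_regret_le hO hErr hE hmono hφ hπ hπφ hh t).trans
      (ENNReal.ofReal_le_ofReal (roundBound_le hW hw t.2))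
  refine (Finset.sum_le_sum fun t _ => hround t).trans ?_
  rw [← ENNReal.ofReal_sum_of_nonneg fun t _ => by positivity, ← Finset.mul_sum, ← Finset.mul_sum]
  refine ENNReal.ofReal_le_ofReal ?_
  have := sum_inv_le_one_add_log N
  gcongr

/-! ### The full run -/

theorem isPolicyFamily_learned (hN : 1 ≤ N) (hO : O.IsMeasurable) (E : ℕ → ℝ)
    (hφ : Measurable φ) {πg : Policy S K} (hπg : IsPolicy πg) (i : ℕ) :
    IsPolicyFamily (learned O E φ πg N i) := by
  induction i with
  | zero => exact ⟨fun _ => hπg, fun h a => (hπg.measurable h a).comp measurable_snd⟩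
  | succ i ih =>
    have hr : Measurable fun (D : Fin (i + 1) → Fin N → Traj S K H) (j : Fin i) => D j.castSucc :=
      measurable_pi_iff.2 fun j => measurable_pi_apply _
    exact (ih.comp hr).replaceStep_mixture hN hO E hφ (H - 1 - i)
      (measurable_pi_apply (Fin.last i))

theorem isFeaturePolicy_learned (hO : O.IsMeasurable) (E : ℕ → ℝ) {πg : Policy S K}
    (hπgφ : IsFeaturePolicy φ πg) (i : ℕ) (D : Fin i → Fin N → Traj S K H) :
    IsFeaturePolicy φ (learned O E φ πg N i D) := by
  induction i with
  | zero => exact hπgφ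
  | succ i ih => exact (ih _).replaceStep_mixture hO E _ _

omit [MeasurableSpace S] [MeasurableSpace X] in
theorem learned_of_lt (O : Oracle S X K H) (E : ℕ → ℝ) (φ : S → X) (πg : Policy S K) {i h : ℕ}
    (hih : h + i < H) (D : Fin i → Fin N → Traj S K H) : learned O E φ πg N i D h = πg h := by
  induction i with
  | zero => rfl
  | succ i ih =>
    rw [learned, replaceStep_of_ne _ (by omega)]
    exact ih (by omega) _

omit [MeasurableSpace S] [MeasurableSpace X] in
theorem learned_snoc (O : Oracle S X K H) (E : ℕ → ℝ) (φ : S → X) (πg : Policy S K) (i : ℕ)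
    (D : Fin i → Fin N → Traj S K H) (D' : Fin N → Traj S K H) :
    learned O E φ πg N (i + 1) (Fin.snoc (α := fun _ => Fin N → Traj S K H) D D')
      = replaceStep (learned O E φ πg N i D) (H - 1 - i) (mixture O E φ (H - 1 - i) D') := by
  simp only [learned, Fin.snoc_castSucc, Fin.snoc_last]

omit [MeasurableSpace X] in
theorem runLaw_eq_seqLaw (M : MDP S K) (O : Oracle S X K H) (E : ℕ → ℝ) (φ : S → X)
    (πg : Policy S K) (N i : ℕ) :
    runLaw M O E φ πg N i = seqLaw (fun i (D : Fin i → Fin N → Traj S K H) =>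
      iterLaw M O E φ (learned O E φ πg N i D) (H - 1 - i) N) i := by
  induction i with
  | zero => rfl
  | succ i ih => rw [runLaw, seqLaw, ih]

theorem isProbabilityMeasure_runLaw (hN : 1 ≤ N) (hO : O.IsMeasurable) (hφ : Measurable φ)
    {πg : Policy S K} (hπg : IsPolicy πg) (i : ℕ) :
    IsProbabilityMeasure (runLaw M O E φ πg N i) := by
  rw [runLaw_eq_seqLaw]
  exact isProbabilityMeasure_seqLaw i
    (fun j _ => measurable_iterLaw hO hφ (isPolicyFamily_learned hN hO E hφ hπg j) _ N)
    fun j _ D => isProbabilityMeasure_iterLaw hO hφ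
      ((isPolicyFamily_learned hN hO E hφ hπg j).isPolicy D) _ N

/-- Regret at a step depends only on the policy from that step on, so an iteration leaves the losses
secured at later steps intact. Its own step is bounded conditionally on the earlier iterations, as a
bandit problem for the policy learned so far. -/
theorem lintegral_learned_regret_le (hN : 1 ≤ N) (hO : O.IsMeasurable) (hErr : O.HasError M φ E)
    (hE : ∀ n, 1 ≤ n → 0 < E n) (hmono : ∀ m n : ℕ, 1 ≤ m → m ≤ n → E n ≤ E m) (hφ : Measurable φ)
    {πg : Policy S K} (hπg : IsPolicy πg) (hπgφ : IsFeaturePolicy φ πg) {W : ℝ}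
    (hW : (H : ℝ) ≤ W) (hw : ∀ m : ℕ, 1 ≤ m → m ≤ N → m * Real.sqrt (K * E m) ≤ W)
    {i : ℕ} (hi : i ≤ H) :
    ∫⁻ D, ∑ j ∈ Finset.range i, ∫⁻ s, ENNReal.ofReal
        (M.regret H (learned O E φ πg N i D) (H - 1 - j) s) ∂M.stateLaw πg (H - 1 - j)
          ∂runLaw M O E φ πg N i
      ≤ i * ENNReal.ofReal (1 / N * (56 * W * (1 + Real.log N))) := by
  induction i with
  | zero => simp
  | succ i ih =>
    have hfam := isPolicyFamily_learned hN hO E hφ hπg (N := N)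
    have hprob := isProbabilityMeasure_runLaw (M := M) (E := E) hN hO hφ hπg
    have hν := MDP.isProbabilityMeasure_stateLaw (M := M) hπg
    have hreg : ∀ i j, Measurable fun D : Fin i → Fin N → Traj S K H => ∫⁻ s, ENNReal.ofReal
        (M.regret H (learned O E φ πg N i D) (H - 1 - j) s) ∂M.stateLaw πg (H - 1 - j) :=
      fun i j => (MDP.measurable_regret_family (hfam i) H
        (H - 1 - j)).ennreal_ofReal.lintegral_prod_right'
    have hold : ∀ (D : Fin i → Fin N → Traj S K H) (D' : Fin N → Traj S K H),
        ∀ j ∈ Finset.range i, M.regret H (replaceStep (learned O E φ πg N i D) (H - 1 - i)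
          (mixture O E φ (H - 1 - i) D')) (H - 1 - j)
          = M.regret H (learned O E φ πg N i D) (H - 1 - j) := fun D D' j hj => by
      have := Finset.mem_range.1 hj
      exact MDP.regret_congr H _ fun l hl => replaceStep_of_ne _ (by omega) _
    rw [runLaw]
    refine (lintegral_bind_snoc (Z := Fin N → Traj S K H)
      (measurable_iterLaw hO hφ (hfam i) (H - 1 - i) N)
      (fun D => isProbabilityMeasure_iterLaw hO hφ ((hfam i).isPolicy D) _ N)
      (Finset.measurable_fun_sum _ fun j _ => hreg (i + 1) j)).trans_le ?_
    simp_rw [learned_snoc, Finset.sum_range_succ]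
    refine le_trans (lintegral_mono fun D => ?_) (?_ : ∫⁻ D, ((∑ j ∈ Finset.range i,
      ∫⁻ s, ENNReal.ofReal (M.regret H (learned O E φ πg N i D) (H - 1 - j) s)
        ∂M.stateLaw πg (H - 1 - j)) + ENNReal.ofReal (1 / N * (56 * W * (1 + Real.log N))))
          ∂runLaw M O E φ πg N i ≤ _)
    · have hp := isProbabilityMeasure_iterLaw (M := M) (E := E) hO hφ ((hfam i).isPolicy D)
        (H - 1 - i) N
      -- Steps before `H - 1 - i` are still those of the guide, so the exploration contexts have
      -- exactly the law required by the coverage argument.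
      have hs : M.stateLaw πg (H - 1 - i)
          = M.stateLaw (learned O E φ πg N i D) (H - 1 - i) :=
        MDP.stateLaw_congr fun l hl => (learned_of_lt O E φ πg (by omega) D).symm
      have e : ∀ D', ∑ j ∈ Finset.range i, ∫⁻ s, ENNReal.ofReal (M.regret H
          (replaceStep (learned O E φ πg N i D) (H - 1 - i) (mixture O E φ (H - 1 - i) D'))
            (H - 1 - j) s) ∂M.stateLaw πg (H - 1 - j)
          = ∑ j ∈ Finset.range i, ∫⁻ s, ENNReal.ofReal (M.regret H (learned O E φ πg N i D)
            (H - 1 - j) s) ∂M.stateLaw πg (H - 1 - j) := fun D' =>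
        Finset.sum_congr rfl fun j hj => by rw [hold D D' j hj]
      simp_rw [e]
      rw [lintegral_add_left measurable_const, lintegral_const, measure_univ, mul_one]
      refine add_le_add le_rfl ?_
      rw [hs]
      exact lintegral_mixture_regret_le hO hErr hE hmono hφ ((hfam i).isPolicy D)
        (isFeaturePolicy_learned hO E hπgφ i D) (by omega) hW hw
    · rw [lintegral_add_left (Finset.measurable_fun_sum _ fun j _ => hreg i j), lintegral_const,
        measure_univ, mul_one, Nat.cast_add, Nat.cast_one, add_mul, one_mul]
      exact add_le_add (ih (by omega)) le_rfl

end Iteration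

end JSRL

end

/-! ### The main theorem -/

theorem mainTheorem4 :
    ∃ c : ℝ, 0 < c ∧
      ∀ (S : Type*) [MeasurableSpace S] (X : Type*) [MeasurableSpace X] (K : ℕ) [NeZero K]
        (H T : ℕ) (_ : 1 ≤ H) (_ : 1 ≤ T)
        (M : MDP S K) (φ : S → X) (_ : Measurable φ)
        (_ : ∀ π : Policy S K, IsPolicy π → IsFeaturePolicy φ π →
          ∀ h < H, ∀ a, DependsOnFeature φ fun s => M.Q H π h s a)
        (πg πstar : Policy S K) (_ : IsPolicy πg) (_ : IsFeaturePolicy φ πg)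
        (_ : M.IsOptimal H πstar)
        (C : ℝ≥0) (_ : M.Covers H φ πg πstar C)
        (E : ℕ → ℝ) (κ : ℝ)
        (_ : ∀ m n : ℕ, 1 ≤ m → m ≤ n → E n ≤ E m)
        (_ : ∀ m n : ℕ, 1 ≤ m → m ≤ n → m * Real.sqrt (E m) ≤ κ * (n * Real.sqrt (E n)))
        (_ : ∀ n : ℕ, 1 ≤ n → (H : ℝ) ≤ κ * (n * Real.sqrt (E n)))
        (O : Oracle S X K H) (_ : O.IsMeasurable) (_ : O.HasError M φ E)
        (N : ℕ) (_ : N = ⌈(T : ℝ) / H⌉₊),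
        IsProbabilityMeasure (runLaw M O E φ πg N H) ∧
        Integrable (fun D => M.gap H πstar (learned O E φ πg N H D)) (runLaw M O E φ πg N H) ∧
        ∫ D, M.gap H πstar (learned O E φ πg N H D) ∂(runLaw M O E φ πg N H)
          ≤ c * κ * (1 + Real.log T) * (C * ∑ _h ∈ Finset.range H, Real.sqrt (K * E N)) := by
  refine ⟨56, by norm_num, ?_⟩
  intro S _ X _ K _ H T hH hT M φ hφ hQ πg πstar hπg hπgφ hopt C hC E κ hmono hκ hκH O hO hErr N hN
  have hH' : (1 : ℝ) ≤ H := by exact_mod_cast hH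
  have hT' : (1 : ℝ) ≤ T := by exact_mod_cast hT
  have hN1 : 1 ≤ N := by
    rw [hN]
    exact Nat.ceil_pos.2 (by positivity)
  have hNT : N ≤ T := by
    rw [hN]
    exact Nat.ceil_le.2 (div_le_self (by positivity) hH')
  -- `Real.sqrt` vanishes at nonpositive arguments, so a nonpositive `E n` would force `H ≤ 0`.
  have hE : ∀ n, 1 ≤ n → 0 < E n := fun n hn => by
    by_contra hle
    have := hκH n hn
    rw [Real.sqrt_eq_zero_of_nonpos (not_lt.1 hle)] at this
    simp only [mul_zero] at this
    linarith
  have hκ0 : 0 ≤ κ := by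
    have h1 := hκH N hN1
    by_contra hneg
    have h2 : κ * (N * Real.sqrt (E N)) ≤ 0 :=
      mul_nonpos_of_nonpos_of_nonneg (not_le.1 hneg).le (by positivity)
    linarith
  have hK : (1 : ℝ) ≤ Real.sqrt K :=
    Real.one_le_sqrt.2 (by exact_mod_cast Nat.pos_of_ne_zero (NeZero.ne K))
  have hsplit : ∀ n, Real.sqrt (K * E n) = Real.sqrt K * Real.sqrt (E n) := fun n =>
    Real.sqrt_mul (Nat.cast_nonneg K) _
  -- This single scale dominates both the initial slack `H` and all `m √(K E(m))` with `m ≤ N`; for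
  -- the former, `√K ≥ 1` is needed.
  set W : ℝ := κ * (N * Real.sqrt (K * E N)) with hWdef
  have hW' : W = Real.sqrt K * (κ * (N * Real.sqrt (E N))) := by rw [hWdef, hsplit]; ring
  have hW : (H : ℝ) ≤ W := by
    have h1 := hκH N hN1
    rw [hW']
    nlinarith
  have hw : ∀ m : ℕ, 1 ≤ m → m ≤ N → m * Real.sqrt (K * E m) ≤ W := fun m hm hmN => by
    rw [hW', hsplit, mul_left_comm]
    exact mul_le_mul_of_nonneg_left (hκ m N hm hmN) (by linarith)
  have hprob := isProbabilityMeasure_runLaw (M := M) (E := E) hN1 hO hφ hπg H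
  have hfam := isPolicyFamily_learned hN1 hO E hφ hπg (N := N) H
  have hgm : Measurable fun D => M.gap H πstar (learned O E φ πg N H D) :=
    measurable_integral_prod (f := fun _ => M.init) (g := fun D s =>
      M.V H πstar 0 s - M.V H (learned O E φ πg N H D) 0 s) measurable_const
      (fun _ => inferInstance) (((MDP.measurable_V hopt.1 H 0).comp measurable_snd).sub
        (MDP.measurable_V_family hfam H 0))
  have hgi : Integrable (fun D => M.gap H πstar (learned O E φ πg N H D))
      (runLaw M O E φ πg N H) := by
    refine integrable_of_abs_le hgm (c := H + H) fun D => ?_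
    simpa [MDP.gap] using norm_integral_le_of_norm_le_const (μ := M.init)
      (f := fun s => M.V H πstar 0 s - M.V H (learned O E φ πg N H D) 0 s)
      (.of_forall fun s => MDP.abs_V_sub_le (hfam.isPolicy D) hopt.1 H 0 s)
  refine ⟨hprob, hgi, ?_⟩
  set B : ℝ := 1 / N * (56 * W * (1 + Real.log N)) with hB
  have hlog : Real.log N ≤ Real.log T :=
    Real.log_le_log (by exact_mod_cast hN1) (by exact_mod_cast hNT)
  have hlog0 : 0 ≤ Real.log N := Real.log_nonneg (by exact_mod_cast hN1)
  have hW0 : 0 ≤ W := by linarith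
  have hB0 : 0 ≤ B := by positivity
  have hlin : ∫⁻ D, ENNReal.ofReal (M.gap H πstar (learned O E φ πg N H D))
      ∂runLaw M O E φ πg N H ≤ ENNReal.ofReal (C * (H * B)) := by
    have h1 : ∀ D, ENNReal.ofReal (M.gap H πstar (learned O E φ πg N H D)) ≤
        C * ∑ j ∈ Finset.range H, ∫⁻ s, ENNReal.ofReal
          (M.regret H (learned O E φ πg N H D) (H - 1 - j) s) ∂M.stateLaw πg (H - 1 - j) :=
      fun D => by
        -- The iterations visit the steps in decreasing order; the performance difference sums them
        -- in increasing order.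
        rw [Finset.sum_range_reflect (fun h => ∫⁻ s, ENNReal.ofReal
          (M.regret H (learned O E φ πg N H D) h s) ∂M.stateLaw πg h)]
        have hφD := isFeaturePolicy_learned (N := N) hO E hπgφ H D
        exact MDP.ofReal_gap_le hφ (hfam.isPolicy D) hopt.1 hπg hC fun h hh =>
          MDP.regret_dependsOnFeature hφD (hQ _ (hfam.isPolicy D) hφD h hh)
    refine (lintegral_mono h1).trans ?_
    rw [lintegral_const_mul' _ _ ENNReal.coe_ne_top, ENNReal.ofReal_mul C.coe_nonneg,
      ENNReal.ofReal_mul (Nat.cast_nonneg H), ENNReal.ofReal_coe_nnreal, ENNReal.ofReal_natCast]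
    exact mul_le_mul_right
      (lintegral_learned_regret_le hN1 hO hErr hE hmono hφ hπg hπgφ hW hw le_rfl) _
  have hint : ∫ D, M.gap H πstar (learned O E φ πg N H D) ∂runLaw M O E φ πg N H
      ≤ C * (H * B) := by
    have h0 : 0 ≤ (C : ℝ) * (H * B) := by positivity
    -- A bound on the positive part suffices, since the negative part only lowers the integral.
    rw [integral_eq_lintegral_pos_part_sub_lintegral_neg_part hgi]
    have h1 := ENNReal.toReal_mono ENNReal.ofReal_ne_top hlin
    rw [ENNReal.toReal_ofReal h0] at h1
    have h2 := ENNReal.toReal_nonneg (a := ∫⁻ D, ENNReal.ofReal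
      (-M.gap H πstar (learned O E φ πg N H D)) ∂runLaw M O E φ πg N H)
    linarith
  refine hint.trans ?_
  have hN0 : (N : ℝ) ≠ 0 := by positivity
  have hB' : B = 56 * κ * (1 + Real.log N) * Real.sqrt (K * E N) := by
    rw [hB, hWdef]
    field_simp
  rw [hB', Finset.sum_const, Finset.card_range, nsmul_eq_mul]
  calc (C : ℝ) * (H * (56 * κ * (1 + Real.log N) * Real.sqrt (K * E N)))
      = 56 * κ * (1 + Real.log N) * (C * (H * Real.sqrt (K * E N))) := by ring
    _ ≤ 56 * κ * (1 + Real.log T) * (C * (H * Real.sqrt (K * E N))) := by gcongr
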